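/- Let $k$ be an algebraically closed field, $R=k[x,y,z]$ with the standard grading, and $d\ge 1$ an integer such that $\operatorname{char} k$ does not divide $d+1$. Let $f\in R$ be a nonzero form of degree $d+1$ that is reduced (i.e. $(f)$ is a radical ideal), let $X=V(f)\subset\mathbb P^2_k$, let $J_f=(f_x,f_y,f_z)$, and let $\mathrm{Syz}(J_f)=\{(s_1,s_2,s_3)\in R^3 : s_1f_x+s_2f_y+s_3f_z=0\}$, graded by the degree of the coordinates. Let $e$ be the least degree of a nonzero homogeneous element of $\mathrm{Syz}(J_f)$, and let $\epsilon\in\mathrm{Syz}(J_f)$ be nonzero and homogeneous of degree $e$. A Bourbaki ideal of $X$ with respect to $\epsilon$ is a homogeneous ideal $I_\epsilon\subseteq R$, either of codimension two or equal to $R$, that fits into an exact sequence of graded $R$-modules $$0\to R(-e)\xrightarrow{\ 1\mapsto\epsilon\ }\mathrm{Syz}(J_f)\to I_\epsilon(e-d)\to 0 .$$ The Bourbaki degree $\mathrm{Bour}(X)$ is the degree (multiplicity) of $R/I_\epsilon$, with the convention that it is $0$ if $I_\epsilon=R$. The curve $X$ is called nearly free with exponents $(a_1,a_2)$, where $1\le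 a_1\le a_2$ are integers, if $R/J_f$ has a graded minimal free resolution of the form $$0\to R(-d-a_2-1)\to R(-d-a_1)\oplus R(-d-a_2)^2\to R(-d)^3\to R\to R/J_f\to 0 ,$$ and nearly free if this holds for some such $a_1,a_2$. Then $\mathrm{Bour}(X)$ is well defined (some $\epsilon$ and $I_\epsilon$ as above exist, and the degree of $R/I_\epsilon$ is the same for all choices), and $\mathrm{Bour}(X)=1$ if and only if $X$ is nearly free. Moreover, if $X$ is nearly free with exponents $(a_1,a_2)$, then $a_1+a_2=d+1$. -/

import Mathlib

open MvPolynomial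

namespace PlaneCurve

section

variable {k : Type*} [Field k]

/-- The gradient ideal `J_f = (f_x, f_y, f_z)`. -/
noncomputable def gradientIdeal (f : MvPolynomial (Fin 3) k) : Ideal (MvPolynomial (Fin 3) k) :=
  Ideal.span (Set.range fun i => pderiv i f)

/-- The module `Syz(J_f) ⊆ R³` of syzygies `(s₀, s₁, s₂)`, `s₀ f_x + s₁ f_y + s₂ f_z = 0`,
graded by the standard degree of the coordinates. -/
noncomputable def syz (f : MvPolynomial (Fin 3) k) :
    Submodule (MvPolynomial (Fin 3) k) (Fin 3 → MvPolynomial (Fin 3) k) :=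
  LinearMap.ker (Fintype.linearCombination (MvPolynomial (Fin 3) k) fun i => pderiv i f)

/-- A vector of `R³` is homogeneous of standard degree `n`. -/
def IsHomogeneousVec (s : Fin 3 → MvPolynomial (Fin 3) k) (n : ℕ) : Prop :=
  ∀ i, (s i).IsHomogeneous n

/-- `e` is the initial degree of `Syz(J_f)`: the least degree of a nonzero homogeneous syzygy. -/
def IsInitialSyzygyDegree (f : MvPolynomial (Fin 3) k) (e : ℕ) : Prop :=
  IsLeast {n : ℕ | ∃ s ∈ syz f, s ≠ 0 ∧ IsHomogeneousVec s n} e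

/-- The Hilbert function `n ↦ dim_k (R/I)_n`. -/
noncomputable def hilbertFunction (I : Ideal (MvPolynomial (Fin 3) k)) (n : ℕ) : ℕ :=
  Module.finrank k
    ((homogeneousSubmodule (Fin 3) k n).map (Ideal.Quotient.mkₐ k I).toLinearMap)

/-- `m` is the degree (multiplicity) of the graded ring `R/I`: the function
`n ↦ ∑_{i < n} dim_k (R/I)_i` agrees for large `n` with a polynomial `P`, and
`m = (deg P)! · (leading coefficient of P)`. In particular it is the length of `R/I` if this is
finite, the eventual value of the Hilbert function if `dim R/I = 1`, and `0` if `I = R`. -/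
def HasDegree (I : Ideal (MvPolynomial (Fin 3) k)) (m : ℕ) : Prop :=
  ∃ P : Polynomial ℚ,
    (∀ᶠ n : ℕ in Filter.atTop,
      ((∑ i ∈ Finset.range n, hilbertFunction I i : ℕ) : ℚ) = P.eval (n : ℚ)) ∧
    (m : ℚ) = (P.natDegree.factorial : ℚ) * P.leadingCoeff

/-- `I` is a Bourbaki ideal of the curve `f = 0` of degree `d + 1` with respect to the syzygy `ε`
of standard degree `e`: a homogeneous ideal, either the unit ideal or of codimension two,
which sits in an exact sequence of graded modules
`0 → R(-e) → Syz(J_f) → I(e - d) → 0` whose first map is `1 ↦ ε`. The map `φ` is the second map,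
read as a map to `R` with image `I`; it sends the degree `n` part to the degree `n + e - d` part. -/
def IsBourbakiIdeal (f : MvPolynomial (Fin 3) k) (d e : ℕ) (ε : syz f)
    (I : Ideal (MvPolynomial (Fin 3) k)) : Prop :=
  (∀ g ∈ I, ∀ n : ℕ, homogeneousComponent n g ∈ I) ∧
  (I = ⊤ ∨ I.height = 2) ∧
  ∃ φ : syz f →ₗ[MvPolynomial (Fin 3) k] MvPolynomial (Fin 3) k,
    LinearMap.ker φ = Submodule.span (MvPolynomial (Fin 3) k) {ε} ∧
    LinearMap.range φ = I ∧
    ∀ (n : ℕ) (s : syz f), IsHomogeneousVec (s : Fin 3 → MvPolynomial (Fin 3) k) n →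
      φ s = 0 ∨ ∃ m : ℕ, m + d = n + e ∧ (φ s).IsHomogeneous m

/-- `b` is a Bourbaki degree of the curve `f = 0` of degree `d + 1`: the degree of `R/I`, where `I`
is a Bourbaki ideal with respect to a nonzero homogeneous syzygy of initial degree (every such
syzygy is a minimal generator of `Syz(J_f)`). -/
def IsBourbakiDegree (f : MvPolynomial (Fin 3) k) (d b : ℕ) : Prop :=
  ∃ (e : ℕ) (ε : syz f) (I : Ideal (MvPolynomial (Fin 3) k)),
    IsInitialSyzygyDegree f e ∧ ε ≠ 0 ∧
    IsHomogeneousVec (ε : Fin 3 → MvPolynomial (Fin 3) k) e ∧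
    IsBourbakiIdeal f d e ε I ∧ HasDegree I b

/-- The matrix `A` defines a degree-zero map `⨁_j R(-b j) → ⨁_i R(-c i)`: its entry `(i, j)` is
zero or homogeneous of degree `b j - c i`. -/
def IsGradedMatrix {ι κ : Type*} (c : ι → ℕ) (b : κ → ℕ)
    (A : Matrix ι κ (MvPolynomial (Fin 3) k)) : Prop :=
  ∀ i j, A i j = 0 ∨ ∃ n : ℕ, b j = c i + n ∧ (A i j).IsHomogeneous n

/-- `R/J` has a graded minimal free resolution of the form
`0 → ⨁ R(-b₃ j) → ⨁ R(-b₂ j) → ⨁ R(-b₁ j) → R → R/J → 0`. Minimality: all entries of the matrices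
lie in the ideal `(x, y, z)`. -/
def HasMinimalResolution (J : Ideal (MvPolynomial (Fin 3) k)) {n₁ n₂ n₃ : ℕ}
    (b₁ : Fin n₁ → ℕ) (b₂ : Fin n₂ → ℕ) (b₃ : Fin n₃ → ℕ) : Prop :=
  ∃ (A₁ : Matrix (Fin 1) (Fin n₁) (MvPolynomial (Fin 3) k))
    (A₂ : Matrix (Fin n₁) (Fin n₂) (MvPolynomial (Fin 3) k))
    (A₃ : Matrix (Fin n₂) (Fin n₃) (MvPolynomial (Fin 3) k)),
    IsGradedMatrix (fun _ => 0) b₁ A₁ ∧ IsGradedMatrix b₁ b₂ A₂ ∧ IsGradedMatrix b₂ b₃ A₃ ∧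
    (∀ i j, constantCoeff (A₁ i j) = 0) ∧
    (∀ i j, constantCoeff (A₂ i j) = 0) ∧
    (∀ i j, constantCoeff (A₃ i j) = 0) ∧
    Ideal.span (Set.range (A₁ 0)) = J ∧
    Function.Exact A₂.mulVecLin A₁.mulVecLin ∧
    Function.Exact A₃.mulVecLin A₂.mulVecLin ∧
    Function.Injective A₃.mulVecLin

/-- The curve `f = 0` of degree `d + 1` is nearly free with exponents `1 ≤ a₁ ≤ a₂`: `R/J_f` has a
graded minimal free resolution
`0 → R(-d-a₂-1) → R(-d-a₁) ⊕ R(-d-a₂)² → R(-d)³ → R → R/J_f → 0`. -/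
def IsNearlyFreeWithExponents (f : MvPolynomial (Fin 3) k) (d a₁ a₂ : ℕ) : Prop :=
  1 ≤ a₁ ∧ a₁ ≤ a₂ ∧
  HasMinimalResolution (gradientIdeal f) ![d, d, d] ![d + a₁, d + a₂, d + a₂] ![d + a₂ + 1]

/-- The curve `f = 0` of degree `d + 1` is nearly free. -/
def IsNearlyFree (f : MvPolynomial (Fin 3) k) (d : ℕ) : Prop :=
  ∃ a₁ a₂ : ℕ, IsNearlyFreeWithExponents f d a₁ a₂

end

end PlaneCurve

/-!
Write `R = k[x, y, z]`. The partial derivatives of `f` have no common factor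
(`isPrimitiveVec_grad`), and neither do the coordinates of a syzygy `ε` of least degree `e`
(`isPrimitiveVec_of_isInitialSyzygyDegree`). Two syzygies `s`, `ε` are both orthogonal to `∇f`, so
`s × ε = φ(s) ∇f` for a unique `φ(s) ∈ R`. The map `φ` is graded of degree `e - d`, its kernel is
`R ε`, and its values on the Koszul syzygies `v × ∇f` are `v · ε`. Hence `I = range φ` contains the
coordinates of `ε` and lies in no proper principal ideal; it therefore has height at least two.
It is moreover saturated with respect to `(x, y, z)` (`isSaturated_range`), by exactness of the
Koszul complex, so that it has height exactly two unless `I = R` (`height_eq_two`). This gives a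
Bourbaki ideal (`exists_isBourbakiIdeal`).

For a Bourbaki ideal `I ≠ R`, saturation provides a linear form `l` that is regular on `R/I`, and
`R/(I, l)` vanishes in large degrees. Thus the Hilbert function of `R/I` does not decrease and is
eventually constant (`hilbertFunction_monotone_and_eventually_const`), its eventual value being the
degree. By additivity of dimensions along the Bourbaki sequence the Hilbert function does not depend
on choices (`hilbertFunction_eq_of_isBourbakiIdeal`), so the Bourbaki degree is well defined.

If the degree is one, the Hilbert function starts at one and is therefore constantly one, which
forces `I` to be the ideal of a point, generated by two independent linear forms
(`IsHomogeneousIdeal.eq_span_linearForm`). Then `ε` and preimages of the two linear forms generate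
`Syz(J_f)`, with one relation, lifting the Koszul relation of the linear forms; this is the
resolution of a nearly free curve with exponents `e` and `d + 1 - e`.

Conversely, after a constant change of basis the resolution of a nearly free curve exhibits three
generators of `Syz(J_f)`, of degrees `a₁`, `a₂`, `a₂`, with one generating relation `r`, whose last
two entries are linear (`IsNearlyFreeWithExponents.exists_generators`). The first generator has
least degree, and the images `g₁`, `g₂` of the other two under `φ` generate `I` and have
`(r₁, r₂)` as generating relation. So `(g₂, -g₁) = u (r₁, r₂)`, where `u` is a unit since `I` lies
in no proper principal ideal. Therefore `I = (r₁, r₂)` is the ideal of a point, of degree one, and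
comparing the degrees of `g₁` and `r₂` gives `a₁ + a₂ = d + 1`.
-/

namespace PlaneCurve

open scoped Matrix

/-! ### Homogeneous components and linear forms -/

section Graded

variable {σ k : Type*} [CommRing k]

attribute [local instance] MvPolynomial.gradedAlgebra

theorem decompose_eq_homogeneousComponent (p : MvPolynomial σ k) (n : ℕ) :
    (DirectSum.decompose (homogeneousSubmodule σ k) p n : MvPolynomial σ k) =
      homogeneousComponent n p :=
  decomposition.decompose'_apply p n

theorem homogeneousComponent_add_mul {g : MvPolynomial σ k} {m : ℕ} (hg : g.IsHomogeneous m)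
    (p : MvPolynomial σ k) (n : ℕ) :
    homogeneousComponent (n + m) (p * g) = homogeneousComponent n p * g := by
  rw [← decompose_eq_homogeneousComponent, ← decompose_eq_homogeneousComponent]
  exact DirectSum.coe_decompose_mul_add_of_right_mem (homogeneousSubmodule σ k) hg

theorem homogeneousComponent_mul_of_lt {g : MvPolynomial σ k} {m n : ℕ} (hg : g.IsHomogeneous m)
    (p : MvPolynomial σ k) (h : n < m) : homogeneousComponent n (p * g) = 0 := by
  rw [← decompose_eq_homogeneousComponent]
  exact DirectSum.coe_decompose_mul_of_right_mem_of_not_le (homogeneousSubmodule σ k) hg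
    (Nat.not_le.mpr h)

theorem eq_of_forall_homogeneousComponent {p q : MvPolynomial σ k}
    (h : ∀ n, homogeneousComponent n p = homogeneousComponent n q) : p = q := by
  ext m
  have := congrArg (coeff m) (h m.degree)
  simpa [coeff_homogeneousComponent] using this

theorem homogeneousComponent_of_isHomogeneous_ne {p : MvPolynomial σ k} {m n : ℕ}
    (hp : p.IsHomogeneous m) (h : n ≠ m) : homogeneousComponent n p = 0 := by
  rw [homogeneousComponent_of_mem hp, if_neg h]

end Graded

/-! ### Primitive vectors over a factorial ring -/

section Primitive

variable {ι A : Type*} [CommRing A]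

/-- A vector is primitive if its coordinates have no common divisor other than units. -/
def IsPrimitiveVec (w : ι → A) : Prop :=
  ∀ h : A, (∀ i, h ∣ w i) → IsUnit h

theorem IsPrimitiveVec.exists_ne_zero [Nontrivial A] {w : ι → A} (hw : IsPrimitiveVec w) :
    ∃ j, w j ≠ 0 := by
  by_contra! h
  exact not_isUnit_zero (hw 0 fun i => by rw [h i])

/-- Over a factorial ring, a vector proportional to a primitive vector `w` over the fraction field
is a multiple of `w`. -/
theorem IsPrimitiveVec.exists_smul_eq [IsDomain A] [UniqueFactorizationMonoid A] [Fintype ι]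
    {w a : ι → A} (hw : IsPrimitiveVec w) (h : ∀ i j, a i * w j = a j * w i) :
    ∃ c : A, a = c • w := by
  classical
  let : StrongNormalizationMonoid A := UniqueFactorizationMonoid.strongNormalizationMonoid
  let : NormalizedGCDMonoid A := UniqueFactorizationMonoid.toNormalizedGCDMonoid A
  obtain ⟨j, hj⟩ := hw.exists_ne_zero
  have hg : IsUnit (Finset.univ.gcd w) := hw _ fun i => Finset.gcd_dvd (Finset.mem_univ i)
  have hdvd : w j ∣ Finset.univ.gcd fun i => a j * w i :=
    Finset.dvd_gcd fun i _ => ⟨a i, by rw [← h i j, mul_comm]⟩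
  obtain ⟨c, hc⟩ : w j ∣ a j :=
    hg.dvd_mul_right.mp (hdvd.trans (Finset.gcd_mul_left' Finset.univ w (a j)).dvd)
  refine ⟨c, funext fun i => mul_right_cancel₀ hj ?_⟩
  rw [h i j, hc, Pi.smul_apply, smul_eq_mul]
  ring

end Primitive

/-! ### Polynomials all of whose partial derivatives vanish -/

section PthPower

variable {σ k : Type*} [Field k]

theorem natCast_eq_zero_of_pderiv_eq_zero {p : MvPolynomial σ k}
    (h : ∀ i, pderiv i p = 0) {m : σ →₀ ℕ} (hm : m ∈ p.support) (i : σ) : ((m i : ℕ) : k) = 0 := by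
  by_cases h0 : m i = 0
  · rw [h0, Nat.cast_zero]
  have h1 := congrArg (coeff (m - Finsupp.single i 1)) (h i)
  rw [coeff_pderiv] at h1
  have h2 : m - Finsupp.single i 1 + Finsupp.single i 1 = m :=
    tsub_add_cancel_of_le (by simpa [Finsupp.single_le_iff] using Nat.one_le_iff_ne_zero.mpr h0)
  rw [h2] at h1
  have h3 : (m - Finsupp.single i 1 : σ →₀ ℕ) i + 1 = m i := by
    have := DFunLike.congr_fun h2 i
    simpa using this
  have h4 : coeff m p * ((m i : ℕ) : k) = 0 := by
    rw [← h3]; simpa using h1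
  exact (mul_eq_zero.mp h4).resolve_left (mem_support_iff.mp hm)

/-- Over a perfect field a polynomial with vanishing partial derivatives is a constant or a
`p`-th power. -/
theorem not_irreducible_of_pderiv_eq_zero [PerfectField k] {p : MvPolynomial σ k}
    (h : ∀ i, pderiv i p = 0) : ¬ Irreducible p := by
  intro hp
  obtain ⟨q, hq⟩ := ExpChar.exists k
  cases hq with
  | zero =>
    have hC : p = C (coeff 0 p) := by
      rw [← totalDegree_eq_zero_iff_eq_C, totalDegree_eq_zero_iff]
      intro m hm i
      exact_mod_cast natCast_eq_zero_of_pderiv_eq_zero h hm i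
    refine hp.not_isUnit ?_
    rw [hC]
    refine IsUnit.map C (isUnit_iff_ne_zero.mpr fun h0 => hp.ne_zero ?_)
    rw [hC, h0, C_0]
  | prime hq' =>
    rename_i hchar
    have : Fact q.Prime := ⟨hq'⟩
    have : ExpChar k q := ExpChar.prime hq'
    have : PerfectRing k q := PerfectField.toPerfectRing q
    have key : (∑ m ∈ p.support, monomial (m.mapRange (· / q) (Nat.zero_div q))
        ((frobeniusEquiv k q).symm (coeff m p))) ^ q = p := by
      rw [sum_pow_char]
      conv_rhs => rw [p.as_sum]
      refine Finset.sum_congr rfl fun m hm => ?_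
      rw [monomial_pow]
      congr 1
      · congr 1
        ext i
        have := (CharP.cast_eq_zero_iff k q (m i)).mp
          (natCast_eq_zero_of_pderiv_eq_zero h hm i)
        simpa using Nat.mul_div_cancel' this
      · exact frobeniusEquiv_symm_pow_p k q _
    -- The coefficients of `p` have `q`-th roots and its exponents are divisible by `q`.
    rw [← key] at hp
    exact not_irreducible_pow hq'.ne_one hp

end PthPower

/-! ### The gradient and its syzygies -/

section Syzygies

variable {k : Type*} [Field k] {f : MvPolynomial (Fin 3) k} {d e : ℕ}

/-- The gradient `(f_x, f_y, f_z)`. -/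
noncomputable def grad (f : MvPolynomial (Fin 3) k) : Fin 3 → MvPolynomial (Fin 3) k :=
  fun i => pderiv i f

theorem mem_syz {s : Fin 3 → MvPolynomial (Fin 3) k} : s ∈ syz f ↔ s ⬝ᵥ grad f = 0 := by
  rw [syz, LinearMap.mem_ker, Fintype.linearCombination_apply]
  rfl

theorem grad_isHomogeneous (hf : f.IsHomogeneous (d + 1)) (i : Fin 3) :
    (grad f i).IsHomogeneous d :=
  hf.pderiv

/-- The partial derivatives of a reduced form have no common factor: by Euler's identity a common
prime factor `p` divides `f`, and since `p²` does not, `p` divides all its own partial derivatives,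
which therefore vanish for degree reasons; over a perfect field this is impossible. -/
theorem isPrimitiveVec_grad [PerfectField k] (hchar : ((d + 1 : ℕ) : k) ≠ 0) (hf0 : f ≠ 0)
    (hf : f.IsHomogeneous (d + 1)) (hred : (Ideal.span {f}).IsRadical) :
    IsPrimitiveVec (grad f) := by
  have hsq : Squarefree f := by
    rwa [← isRadical_iff_squarefree_of_ne_zero hf0, isRadical_iff_span_singleton]
  have euler : ∀ h : MvPolynomial (Fin 3) k, (∀ i, h ∣ grad f i) → h ∣ f := by
    intro h hh
    have h1 : h ∣ (d + 1) • f := by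
      rw [← hf.sum_X_mul_pderiv]
      exact Finset.dvd_sum fun i _ => (hh i).mul_left _
    have h2 : (d + 1) • f = C ((d + 1 : ℕ) : k) * f := by
      rw [nsmul_eq_mul, map_natCast]
    rw [h2] at h1
    exact ((IsUnit.mk0 _ hchar).map C).dvd_mul_left.mp h1
  intro h hh
  by_contra hu
  have h0 : h ≠ 0 := by
    rintro rfl
    exact hf0 (zero_dvd_iff.mp (euler 0 hh))
  obtain ⟨p, hp, hph⟩ := WfDvdMonoid.exists_irreducible_factor hu h0
  have hpg : ∀ i, p ∣ grad f i := fun i => hph.trans (hh i)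
  obtain ⟨g, rfl⟩ := euler p hpg
  have hndvd : ¬ p ∣ g := fun hpg => hp.not_isUnit (hsq p (mul_dvd_mul_left p hpg))
  refine not_irreducible_of_pderiv_eq_zero (fun i => ?_) hp
  have h1 : p ∣ pderiv i p * g := by
    have := hpg i
    rw [grad, Derivation.leibniz, smul_eq_mul, smul_eq_mul,
      dvd_add_right (dvd_mul_right _ _), mul_comm] at this
    exact this
  -- The derivative of `p` is divisible by `p` but has smaller degree.
  have h2 : p ∣ pderiv i p := (hp.prime.dvd_or_dvd h1).resolve_right hndvd
  by_contra h3
  obtain ⟨q, hq⟩ := h2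
  have h4 : (pderiv i p).totalDegree < p.totalDegree := by
    by_cases h5 : p.totalDegree = 0
    · refine absurd ?_ h3
      rw [totalDegree_eq_zero_iff_eq_C.mp h5, pderiv_C]
    · rw [totalDegree, Finset.sup_lt_iff (by simpa using Nat.pos_of_ne_zero h5)]
      intro m hm
      rw [mem_support_iff, coeff_pderiv] at hm
      have := le_totalDegree (mem_support_iff.mpr (left_ne_zero_of_mul hm))
      rw [Finsupp.sum_add_index' (fun _ => rfl) (fun _ _ _ => rfl),
        Finsupp.sum_single_index rfl] at this
      omega
  rw [hq, totalDegree_mul_of_isDomain hp.ne_zero (by rintro rfl; simp [hq] at h3)] at h4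
  omega

theorem vecComponent_mem_syz (hf : f.IsHomogeneous (d + 1)) {s : Fin 3 → MvPolynomial (Fin 3) k}
    (hs : s ∈ syz f) (n : ℕ) : (fun i => homogeneousComponent n (s i)) ∈ syz f := by
  rw [mem_syz, dotProduct] at hs ⊢
  have := congrArg (homogeneousComponent (n + d)) hs
  rw [map_sum, map_zero] at this
  rw [← this]
  exact Finset.sum_congr rfl fun i _ =>
    (homogeneousComponent_add_mul (grad_isHomogeneous hf i) _ _).symm

/-- A syzygy of least degree is primitive: a common factor could be divided out, and a homogeneous
component of the quotient would be a syzygy of smaller degree. -/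
theorem isPrimitiveVec_of_isInitialSyzygyDegree (hf : f.IsHomogeneous (d + 1))
    (he : IsInitialSyzygyDegree f e) {ε : Fin 3 → MvPolynomial (Fin 3) k} (hε : ε ∈ syz f)
    (hε0 : ε ≠ 0) (hεh : IsHomogeneousVec ε e) : IsPrimitiveVec ε := by
  intro h hh
  choose η hη using hh
  have h0 : h ≠ 0 := by
    rintro rfl
    exact hε0 (funext fun i => by rw [hη i, zero_mul, Pi.zero_apply])
  have hηs : η ∈ syz f := by
    rw [mem_syz] at hε ⊢
    have : h * (η ⬝ᵥ grad f) = 0 := by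
      rw [← hε, dotProduct, dotProduct, Finset.mul_sum]
      exact Finset.sum_congr rfl fun i _ => by rw [hη i, mul_assoc]
    exact (mul_eq_zero.mp this).resolve_left h0
  obtain ⟨i, hi⟩ : ∃ i, η i ≠ 0 := by
    by_contra! hall
    exact hε0 (funext fun i => by rw [hη i, hall i, mul_zero, Pi.zero_apply])
  obtain ⟨n, hn⟩ : ∃ n, homogeneousComponent n (η i) ≠ 0 := by
    by_contra! hall
    exact hi (eq_of_forall_homogeneousComponent fun n => by rw [hall n, map_zero])
  have hen : e ≤ n := he.2 ⟨_, vecComponent_mem_syz hf hηs n, fun h1 => hn (congrFun h1 i),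
    fun j => homogeneousComponent_isHomogeneous n (η j)⟩
  have hnd : n ≤ (η i).totalDegree := by
    by_contra! hlt
    exact hn (homogeneousComponent_eq_zero n _ hlt)
  have hdeg : h.totalDegree + (η i).totalDegree = e := by
    rw [← totalDegree_mul_of_isDomain h0 hi, ← hη i]
    exact (hεh i).totalDegree (by rw [hη i]; exact mul_ne_zero h0 hi)
  have hC := totalDegree_eq_zero_iff_eq_C.mp (show h.totalDegree = 0 by omega)
  rw [hC]
  refine (IsUnit.mk0 _ fun h1 => h0 ?_).map C
  rw [hC, h1, C_0]

/-- The Koszul syzygies `v × ∇f`. -/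
theorem cross_grad_mem_syz (v : Fin 3 → MvPolynomial (Fin 3) k) : v ⨯₃ grad f ∈ syz f := by
  rw [mem_syz, dotProduct_comm]
  exact dot_cross_self _ _

theorem cross_eq_zero_iff {A : Type*} [CommRing A] {a b : Fin 3 → A} :
    a ⨯₃ b = 0 ↔ ∀ i j, a i * b j = a j * b i := by
  constructor
  · intro h i j
    have h0 := congrFun h 0
    have h1 := congrFun h 1
    have h2 := congrFun h 2
    simp only [cross_apply, Matrix.cons_val_zero, Matrix.cons_val_one, Matrix.cons_val,
      Pi.zero_apply] at h0 h1 h2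
    fin_cases i <;> fin_cases j <;> simp only [Fin.zero_eta, Fin.mk_one, Fin.reduceFinMk] <;>
      first | ring | linear_combination h0 | linear_combination h1 | linear_combination h2 |
        linear_combination -h0 | linear_combination -h1 | linear_combination -h2
  · intro h
    ext i
    fin_cases i <;> simp [cross_apply, h 1 2, h 2 0, h 0 1]

theorem exists_single_cross_ne_zero {A : Type*} [CommRing A] {g : Fin 3 → A} {j : Fin 3}
    (hj : g j ≠ 0) : ∃ i : Fin 3, (Pi.single i 1 : Fin 3 → A) ⨯₃ g ≠ 0 := by
  by_contra! h
  have h0 := cross_eq_zero_iff.mp (h 0)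
  have h1 := cross_eq_zero_iff.mp (h 1)
  apply hj
  fin_cases j
  · simpa using h1 1 0
  · simpa using h0 0 1
  · simpa using h0 0 2

theorem isHomogeneousVec_cross {a b : Fin 3 → MvPolynomial (Fin 3) k} {m n : ℕ}
    (ha : IsHomogeneousVec a m) (hb : IsHomogeneousVec b n) :
    IsHomogeneousVec (a ⨯₃ b) (m + n) := by
  intro i
  rw [cross_apply]
  fin_cases i
  exacts [((ha _).mul (hb _)).sub ((ha _).mul (hb _)), ((ha _).mul (hb _)).sub ((ha _).mul (hb _)),
    ((ha _).mul (hb _)).sub ((ha _).mul (hb _))]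

theorem isHomogeneousVec_single (i : Fin 3) :
    IsHomogeneousVec (Pi.single i 1 : Fin 3 → MvPolynomial (Fin 3) k) 0 := by
  intro j
  by_cases h : j = i
  · subst h
    simpa using isHomogeneous_one (Fin 3) k
  · simpa [h] using isHomogeneous_zero (Fin 3) k 0

theorem exists_koszul_syzygy (hf : f.IsHomogeneous (d + 1)) (hg : IsPrimitiveVec (grad f)) :
    ∃ s ∈ syz f, s ≠ 0 ∧ IsHomogeneousVec s d := by
  obtain ⟨j, hj⟩ := hg.exists_ne_zero
  obtain ⟨i, hi⟩ := exists_single_cross_ne_zero hj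
  refine ⟨_, cross_grad_mem_syz _, hi, ?_⟩
  simpa using isHomogeneousVec_cross (isHomogeneousVec_single i) (grad_isHomogeneous hf)

theorem exists_isInitialSyzygyDegree (hf : f.IsHomogeneous (d + 1))
    (hg : IsPrimitiveVec (grad f)) : ∃ e, IsInitialSyzygyDegree f e := by
  classical
  have h : ∃ n, ∃ s ∈ syz f, s ≠ 0 ∧ IsHomogeneousVec s n := ⟨d, exists_koszul_syzygy hf hg⟩
  exact ⟨Nat.find h, Nat.find_spec h, fun n hn => Nat.find_min' h hn⟩

theorem IsInitialSyzygyDegree.le (he : IsInitialSyzygyDegree f e) (hf : f.IsHomogeneous (d + 1))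
    (hg : IsPrimitiveVec (grad f)) : e ≤ d :=
  he.2 (exists_koszul_syzygy hf hg)

/-! ### The map from syzygies to the Bourbaki ideal -/

/-- `φ` expresses the cross product with `ε` as a multiple of the gradient: two syzygies are both
orthogonal to `∇f`, so their cross product is proportional to `∇f`. -/
def IsCrossMap (f : MvPolynomial (Fin 3) k) (ε : Fin 3 → MvPolynomial (Fin 3) k)
    (φ : syz f →ₗ[MvPolynomial (Fin 3) k] MvPolynomial (Fin 3) k) : Prop :=
  ∀ s : syz f, (s : Fin 3 → MvPolynomial (Fin 3) k) ⨯₃ ε = φ s • grad f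

theorem exists_isCrossMap (hg : IsPrimitiveVec (grad f)) {ε : Fin 3 → MvPolynomial (Fin 3) k}
    (hε : ε ∈ syz f) : ∃ φ, IsCrossMap f ε φ := by
  obtain ⟨j, hj⟩ := hg.exists_ne_zero
  have key : ∀ s : syz f, ∃ c : MvPolynomial (Fin 3) k,
      (s : Fin 3 → MvPolynomial (Fin 3) k) ⨯₃ ε = c • grad f := by
    intro s
    refine hg.exists_smul_eq (cross_eq_zero_iff.mp ?_)
    rw [cross_cross_eq_smul_sub_smul, mem_syz.mp s.2, mem_syz.mp hε, zero_smul, zero_smul,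
      sub_zero]
  choose c hc using key
  refine ⟨{ toFun := c, map_add' := fun s t => ?_, map_smul' := fun r s => ?_ }, hc⟩
  · refine mul_right_cancel₀ hj ?_
    have := congrFun (hc (s + t)) j
    rw [Submodule.coe_add, map_add, LinearMap.add_apply, hc, hc, Pi.add_apply, Pi.smul_apply,
      Pi.smul_apply, Pi.smul_apply, smul_eq_mul, smul_eq_mul, smul_eq_mul] at this
    rw [← this]; ring
  · refine mul_right_cancel₀ hj ?_
    have := congrFun (hc (r • s)) j
    rw [Submodule.coe_smul, map_smul, LinearMap.smul_apply, hc, Pi.smul_apply, Pi.smul_apply,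
      Pi.smul_apply, smul_eq_mul, smul_eq_mul, smul_eq_mul] at this
    rw [← this, RingHom.id_apply, smul_eq_mul]; ring

variable {ε : Fin 3 → MvPolynomial (Fin 3) k}
  {φ : syz f →ₗ[MvPolynomial (Fin 3) k] MvPolynomial (Fin 3) k}

theorem IsCrossMap.ker_eq (hφ : IsCrossMap f ε φ) (hg : IsPrimitiveVec (grad f))
    (hε : ε ∈ syz f) (hεp : IsPrimitiveVec ε) :
    LinearMap.ker φ = Submodule.span (MvPolynomial (Fin 3) k) {(⟨ε, hε⟩ : syz f)} := by
  obtain ⟨j, hj⟩ := hg.exists_ne_zero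
  ext s
  rw [LinearMap.mem_ker, Submodule.mem_span_singleton]
  constructor
  · intro h
    obtain ⟨c, hc⟩ := hεp.exists_smul_eq (cross_eq_zero_iff.mp (by rw [hφ s, h, zero_smul]))
    exact ⟨c, Subtype.ext hc.symm⟩
  · rintro ⟨c, rfl⟩
    have h1 := congrFun (hφ ⟨ε, hε⟩) j
    rw [cross_self, Pi.zero_apply, Pi.smul_apply, smul_eq_mul] at h1
    rw [map_smul, (mul_eq_zero.mp h1.symm).resolve_right hj, smul_zero]

/-- The values at Koszul syzygies: the ideal `range φ` contains the coordinates of `ε`. -/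
theorem IsCrossMap.apply_mem_range (hφ : IsCrossMap f ε φ) (hg : IsPrimitiveVec (grad f))
    (hε : ε ∈ syz f) (i : Fin 3) : ε i ∈ LinearMap.range φ := by
  obtain ⟨j, hj⟩ := hg.exists_ne_zero
  refine ⟨⟨_, cross_grad_mem_syz (f := f) (Pi.single i 1)⟩, mul_right_cancel₀ hj ?_⟩
  have := congrFun (hφ ⟨_, cross_grad_mem_syz (f := f) (Pi.single i 1)⟩) j
  rw [cross_cross_eq_smul_sub_smul, dotProduct_comm (grad f), mem_syz.mp hε, zero_smul, sub_zero,
    single_one_dotProduct] at this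
  exact this.symm

/-- A cofactor of a nonzero form in a form is itself a form. -/
theorem exists_isHomogeneous_of_mul {p g : MvPolynomial (Fin 3) k} {N : ℕ}
    (hg : g.IsHomogeneous d) (hg0 : g ≠ 0) (h : (p * g).IsHomogeneous N) (hp : p ≠ 0) :
    ∃ m, m + d = N ∧ p.IsHomogeneous m := by
  have hdeg : p.totalDegree + d = N := by
    rw [← h.totalDegree (mul_ne_zero hp hg0), totalDegree_mul_of_isDomain hp hg0,
      hg.totalDegree hg0]
  refine ⟨_, hdeg, ?_⟩
  have : p = homogeneousComponent p.totalDegree p := by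
    refine eq_of_forall_homogeneousComponent fun n => ?_
    by_cases hn : n = p.totalDegree
    · rw [← hn, homogeneousComponent_of_mem (homogeneousComponent_isHomogeneous n p), if_pos rfl]
    · rw [homogeneousComponent_of_isHomogeneous_ne (homogeneousComponent_isHomogeneous _ p) hn]
      refine (mul_eq_zero.mp ?_).resolve_right hg0
      rw [← homogeneousComponent_add_mul hg]
      exact homogeneousComponent_of_isHomogeneous_ne h (by omega)
  have h2 := homogeneousComponent_isHomogeneous p.totalDegree p
  rwa [← this] at h2

/-- `φ` is a graded map of degree `e - d`, as required of the second map of a Bourbaki sequence. -/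
def IsGradedSyzMap (f : MvPolynomial (Fin 3) k) (d e : ℕ)
    (φ : syz f →ₗ[MvPolynomial (Fin 3) k] MvPolynomial (Fin 3) k) : Prop :=
  ∀ (n : ℕ) (s : syz f), IsHomogeneousVec (s : Fin 3 → MvPolynomial (Fin 3) k) n →
    φ s = 0 ∨ ∃ m : ℕ, m + d = n + e ∧ (φ s).IsHomogeneous m

theorem IsCrossMap.isGradedSyzMap (hφ : IsCrossMap f ε φ) (hf : f.IsHomogeneous (d + 1))
    (hg : IsPrimitiveVec (grad f)) (hεh : IsHomogeneousVec ε e) : IsGradedSyzMap f d e φ := by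
  intro n s hs
  obtain ⟨j, hj⟩ := hg.exists_ne_zero
  refine or_iff_not_imp_left.mpr fun h0 => ?_
  refine exists_isHomogeneous_of_mul (grad_isHomogeneous hf j) hj ?_ h0
  have := isHomogeneousVec_cross hs hεh j
  rwa [hφ s] at this

end Syzygies

/-! ### Saturation of Bourbaki ideals -/

section Saturation

variable {k : Type*} [Field k]

theorem isPrimitiveVec_X : IsPrimitiveVec (X : Fin 3 → MvPolynomial (Fin 3) k) := by
  intro h hh
  by_contra hu
  have hirr : Irreducible (X 0 : MvPolynomial (Fin 3) k) := (X_prime (i := 0)).irreducible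
  have h1 : (X 0 : MvPolynomial (Fin 3) k) ∣ h :=
    ((hirr.dvd_iff.mp (hh 0)).resolve_left hu).dvd
  have h2 := X_dvd_X.mp (h1.trans (hh 1))
  exact absurd h2 (by decide)

/-- Setting the variable `X i` to zero does not change a polynomial modulo `X i`. -/
theorem X_dvd_sub_aeval {σ : Type*} [DecidableEq σ] (i : σ) (p : MvPolynomial σ k) :
    X i ∣ p - aeval (Function.update X i 0) p := by
  rw [← Ideal.mem_span_singleton, ← Ideal.Quotient.mk_eq_mk_iff_sub_mem]
  have : (Ideal.Quotient.mkₐ k (Ideal.span {(X i : MvPolynomial σ k)})) =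
      (Ideal.Quotient.mkₐ k (Ideal.span {(X i : MvPolynomial σ k)})).comp
        (aeval (Function.update X i 0)) := by
    refine algHom_ext fun j => ?_
    rw [AlgHom.comp_apply, aeval_X]
    by_cases h : j = i
    · subst h
      rw [Function.update_self, map_zero]
      exact Ideal.Quotient.eq_zero_iff_mem.mpr (Ideal.mem_span_singleton_self _)
    · rw [Function.update_of_ne h]
  exact DFunLike.congr_fun this p

/-- Exactness of the Koszul complex of `(x, y, z)` at its first homology. -/
theorem exists_eq_cross_X {v : Fin 3 → MvPolynomial (Fin 3) k} (h : v ⬝ᵥ X = 0) :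
    ∃ u : Fin 3 → MvPolynomial (Fin 3) k, v = u ⨯₃ X := by
  have h1 : v 0 * X 0 + v 1 * X 1 + v 2 * X 2 = 0 := by rwa [← Matrix.vec3_dotProduct]
  let ψ : MvPolynomial (Fin 3) k →ₐ[k] MvPolynomial (Fin 3) k := aeval (Function.update X 0 0)
  have h0 : ψ (v 1) * X 1 + ψ (v 2) * X 2 = 0 := by
    have := congrArg ψ h1
    simpa [ψ] using this
  obtain ⟨b, hb⟩ := X_dvd_sub_aeval 0 (v 1)
  obtain ⟨c, hc⟩ := X_dvd_sub_aeval 0 (v 2)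
  change v 1 - ψ (v 1) = _ at hb
  change v 2 - ψ (v 2) = _ at hc
  obtain ⟨u, hu⟩ : X 1 ∣ ψ (v 2) := by
    have h2 : X 1 ∣ ψ (v 2) * X 2 := ⟨-ψ (v 1), by linear_combination h0⟩
    exact (X_dvd_mul_iff.mp h2).resolve_right fun h3 => absurd (X_dvd_X.mp h3) (by decide)
  have hv1 : ψ (v 1) = -(X 2 * u) := by
    refine mul_right_cancel₀ (X_ne_zero (1 : Fin 3)) ?_
    linear_combination h0 - X 2 * hu
  refine ⟨![u, -c, b], ?_⟩
  ext1 i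
  rw [cross_apply]
  fin_cases i
  · refine mul_right_cancel₀ (X_ne_zero (0 : Fin 3)) ?_
    simp only [Fin.zero_eta, Matrix.cons_val]
    linear_combination h1 - X 1 * hb - X 2 * hc - X 1 * hv1 - X 2 * hu
  · simp only [Fin.mk_one, Matrix.cons_val]
    linear_combination hb + hv1
  · simp only [Fin.reduceFinMk, Matrix.cons_val]
    linear_combination hc + hu

/-- An ideal `I` is saturated with respect to the ideal `(x, y, z)`. -/
def IsSaturated (I : Ideal (MvPolynomial (Fin 3) k)) : Prop :=
  ∀ g, (∀ i, X i * g ∈ I) → g ∈ I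

/-- The cokernel of `ε` in the syzygy module is saturated. Given preimages `s i` of `X i * g`, the
vector `s × X` has entries in `R ε`; by exactness of the Koszul complex the `s i` may be changed by
multiples of `ε` such that it vanishes, and then `s i = X i • t` for a preimage `t` of `g`. -/
theorem isSaturated_range {f : MvPolynomial (Fin 3) k} {ε : syz f} (hε : ε ≠ 0)
    {φ : syz f →ₗ[MvPolynomial (Fin 3) k] MvPolynomial (Fin 3) k}
    (hφ : LinearMap.ker φ = Submodule.span (MvPolynomial (Fin 3) k) {ε}) :
    IsSaturated (LinearMap.range φ : Ideal (MvPolynomial (Fin 3) k)) := by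
  intro g hg
  choose s hs using hg
  have hker : ∀ i j, ∃ c : MvPolynomial (Fin 3) k,
      c • ε = (X j : MvPolynomial (Fin 3) k) • s i - (X i : MvPolynomial (Fin 3) k) • s j := by
    intro i j
    rw [← Submodule.mem_span_singleton, ← hφ, LinearMap.mem_ker, map_sub, map_smul, map_smul, hs,
      hs, smul_eq_mul, smul_eq_mul]
    ring
  choose c hc using hker
  have hXv : ![c 1 2, c 2 0, c 0 1] ⬝ᵥ (X : Fin 3 → MvPolynomial (Fin 3) k) = 0 := by
    have : (c 1 2 * X 0 + c 2 0 * X 1 + c 0 1 * X 2) • ε = 0 := by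
      rw [add_smul, add_smul, mul_comm, mul_comm (c 2 0), mul_comm (c 0 1), mul_smul, mul_smul,
        mul_smul, hc, hc, hc]
      module
    rw [Matrix.vec3_dotProduct]
    exact (smul_eq_zero.mp this).resolve_right hε
  obtain ⟨u, hu⟩ := exists_eq_cross_X hXv
  have hu0 := congrFun hu 0
  have hu1 := congrFun hu 1
  have hu2 := congrFun hu 2
  simp only [cross_apply, Matrix.cons_val] at hu0 hu1 hu2
  have h12 : (X 2 : MvPolynomial (Fin 3) k) • (s 1 - u 1 • ε) =
      (X 1 : MvPolynomial (Fin 3) k) • (s 2 - u 2 • ε) := by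
    have := hc 1 2
    rw [hu0] at this
    rw [smul_sub, smul_sub, sub_eq_sub_iff_sub_eq_sub, ← this]
    module
  have h20 : (X 0 : MvPolynomial (Fin 3) k) • (s 2 - u 2 • ε) =
      (X 2 : MvPolynomial (Fin 3) k) • (s 0 - u 0 • ε) := by
    have := hc 2 0
    rw [hu1] at this
    rw [smul_sub, smul_sub, sub_eq_sub_iff_sub_eq_sub, ← this]
    module
  have h01 : (X 1 : MvPolynomial (Fin 3) k) • (s 0 - u 0 • ε) =
      (X 0 : MvPolynomial (Fin 3) k) • (s 1 - u 1 • ε) := by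
    have := hc 0 1
    rw [hu2] at this
    rw [smul_sub, smul_sub, sub_eq_sub_iff_sub_eq_sub, ← this]
    module
  have hall : ∀ i j, (X j : MvPolynomial (Fin 3) k) • (s i - u i • ε) =
      (X i : MvPolynomial (Fin 3) k) • (s j - u j • ε) := by
    intro i j
    fin_cases i <;> fin_cases j
    exacts [rfl, h01, h20.symm, h01.symm, rfl, h12, h20, h12.symm, rfl]
  have ht : ∀ l, ∃ t : MvPolynomial (Fin 3) k,
      (fun i => ((s i - u i • ε : syz f) : Fin 3 → MvPolynomial (Fin 3) k) l) = t • X := by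
    intro l
    refine isPrimitiveVec_X.exists_smul_eq fun i j => ?_
    have := congrFun (congrArg Subtype.val (hall i j)) l
    rw [mul_comm, mul_comm _ (X i)]
    exact this
  choose t ht using ht
  have ht' : ∀ i, ((s i - u i • ε : syz f) : Fin 3 → MvPolynomial (Fin 3) k) =
      (X i : MvPolynomial (Fin 3) k) • t := by
    intro i
    ext1 l
    rw [congrFun (ht l) i, Pi.smul_apply, Pi.smul_apply, smul_eq_mul, smul_eq_mul, mul_comm]
  have hts : t ∈ syz f := by
    have h1 := (s 0 - u 0 • ε).2
    rw [ht', mem_syz, smul_dotProduct, smul_eq_mul] at h1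
    exact mem_syz.mpr ((mul_eq_zero.mp h1).resolve_left (X_ne_zero _))
  refine ⟨⟨t, hts⟩, mul_left_cancel₀ (X_ne_zero (0 : Fin 3)) ?_⟩
  have h1 : s 0 - u 0 • ε = (X 0 : MvPolynomial (Fin 3) k) • (⟨t, hts⟩ : syz f) :=
    Subtype.ext (ht' 0)
  have h2 : φ ε = 0 := by
    rw [← LinearMap.mem_ker, hφ]
    exact Submodule.mem_span_singleton_self ε
  rw [← smul_eq_mul, ← map_smul, ← h1, map_sub, map_smul, h2, smul_zero, sub_zero, hs]

end Saturation

/-! ### Heights -/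

section Height

theorem two_le_height_of_isPrimitiveVec {ι A : Type*} [CommRing A] [IsDomain A]
    [UniqueFactorizationMonoid A] {w : ι → A} (hw : IsPrimitiveVec w) {P : Ideal A}
    [hP : P.IsPrime] (h : ∀ i, w i ∈ P) : 2 ≤ P.height := by
  have hbot : P ≠ ⊥ := by
    rintro rfl
    obtain ⟨j, hj⟩ := hw.exists_ne_zero
    exact hj (h j)
  obtain ⟨p, hpP, hp⟩ := hP.exists_mem_prime_of_ne_bot hbot
  have hprime : (Ideal.span {p}).IsPrime := (Ideal.span_singleton_prime hp.ne_zero).mpr hp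
  -- The chain `0 < (p) < P` of primes, strict since `p` does not divide all `w i`.
  have hlt : Ideal.span {p} < P := by
    refine lt_of_le_of_ne ((Ideal.span_singleton_le_iff_mem P).mpr hpP) fun heq => ?_
    exact hp.not_isUnit (hw p fun i => Ideal.mem_span_singleton.mp (heq ▸ h i))
  have hlt' : ⊥ < Ideal.span {p} := by
    rw [bot_lt_iff_ne_bot, Ne, Ideal.span_singleton_eq_bot]
    exact hp.ne_zero
  have h1 := Ideal.height_add_one_le_of_lt_of_isPrime hlt'
  have h2 := Ideal.height_add_one_le_of_lt_of_isPrime hlt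
  rw [Ideal.height_bot, zero_add] at h1
  calc (2 : ℕ∞) = 1 + 1 := by norm_num
    _ ≤ _ := add_le_add_left h1 1
    _ ≤ _ := h2

variable {k : Type*} [Field k]

theorem isMaximal_of_three_le_height {P : Ideal (MvPolynomial (Fin 3) k)} [hP : P.IsPrime]
    (h : 3 ≤ P.height) : P.IsMaximal := by
  obtain ⟨M, hM, hPM⟩ := P.exists_le_maximal hP.ne_top
  rcases hPM.eq_or_lt with rfl | hlt
  · exact hM
  exfalso
  have h1 := Ideal.height_add_one_le_of_lt_of_isPrime hlt
  have h2 : ((M.height : ℕ∞) : WithBot ℕ∞) ≤ _ := Ideal.height_le_ringKrullDim_of_isPrime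
  rw [MvPolynomial.ringKrullDim_of_isNoetherianRing, ringKrullDim_eq_zero_of_field, zero_add,
    Nat.card_eq_fintype_card, Fintype.card_fin] at h2
  have h3 : M.height ≤ ((3 : ℕ) : ℕ∞) := WithBot.coe_le_coe.mp h2
  have h4 : (3 : ℕ∞) + 1 ≤ 3 := (add_le_add_left h 1).trans (h1.trans h3)
  exact absurd h4 (by decide)

/-- Closure under taking homogeneous components. -/
def IsHomogeneousIdeal (I : Ideal (MvPolynomial (Fin 3) k)) : Prop :=
  ∀ g ∈ I, ∀ n : ℕ, homogeneousComponent n g ∈ I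

attribute [local instance] MvPolynomial.gradedAlgebra

theorem IsHomogeneousIdeal.isHomogeneous {I : Ideal (MvPolynomial (Fin 3) k)}
    (hI : IsHomogeneousIdeal I) : I.IsHomogeneous (homogeneousSubmodule (Fin 3) k) := by
  intro n g hg
  rw [decompose_eq_homogeneousComponent]
  exact hI g hg n

/-- If all primes containing a homogeneous ideal are maximal, it contains all forms of large
degree: the primes containing it contain homogeneous such primes and hence are all equal to
`(x, y, z)`. -/
theorem IsHomogeneousIdeal.exists_forall_mem {I : Ideal (MvPolynomial (Fin 3) k)}
    (hI : IsHomogeneousIdeal I) (h : ∀ Q : Ideal (MvPolynomial (Fin 3) k), Q.IsPrime → I ≤ Q →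
      Q.IsMaximal) :
    ∃ N, ∀ n, N ≤ n → ∀ g : MvPolynomial (Fin 3) k, g.IsHomogeneous n → g ∈ I := by
  have hrad : idealOfVars (Fin 3) k ≤ I.radical := by
    rw [Ideal.radical_eq_sInf]
    refine le_sInf fun Q ⟨hIQ, hQ⟩ => ?_
    let Q' := (Q.homogeneousCore (homogeneousSubmodule (Fin 3) k)).toIdeal
    have hQ'Q : Q' ≤ Q := Ideal.toIdeal_homogeneousCore_le _ Q
    have hIQ' : I ≤ Q' := by
      rw [← hI.isHomogeneous.toIdeal_homogeneousCore_eq_self]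
      exact Ideal.homogeneousCore_mono _ hIQ
    have hmax : Q'.IsMaximal := h Q' hQ.homogeneousCore hIQ'
    have hQ'hom : Q'.IsHomogeneous (homogeneousSubmodule (Fin 3) k) :=
      (Q.homogeneousCore (homogeneousSubmodule (Fin 3) k)).isHomogeneous
    have hle : Q' ≤ RingHom.ker (constantCoeff (σ := Fin 3) (R := k)) := by
      intro g hg
      rw [RingHom.mem_ker]
      by_contra h0
      have := homogeneousComponent_mem_of_mem hQ'hom hg 0
      rw [homogeneousComponent_zero] at this
      exact hmax.ne_top (Ideal.eq_top_of_isUnit_mem _ this ((IsUnit.mk0 _ h0).map C))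
    have hne : RingHom.ker (constantCoeff (σ := Fin 3) (R := k)) ≠ ⊤ := by
      rw [Ne, Ideal.eq_top_iff_one, RingHom.mem_ker, map_one]
      exact one_ne_zero
    refine le_trans ?_ hQ'Q
    rw [hmax.eq_of_le hne hle, idealOfVars, Ideal.span_le]
    rintro _ ⟨i, rfl⟩
    exact constantCoeff_X k i
  obtain ⟨N, hN⟩ := Ideal.exists_radical_pow_le_of_fg I I.radical.fg_of_isNoetherianRing
  refine ⟨N, fun n hn g hg => hN (Ideal.pow_right_mono hrad N ?_)⟩
  rw [mem_pow_idealOfVars_iff]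
  intro m hm
  rwa [hg.degree_eq_sum_deg_support hm] at hn

/-- A saturated ideal containing all forms of large degree is the unit ideal, by descending
induction on the degree. -/
theorem IsSaturated.eq_top {I : Ideal (MvPolynomial (Fin 3) k)} (hs : IsSaturated I)
    (h : ∃ N, ∀ n, N ≤ n → ∀ g : MvPolynomial (Fin 3) k, g.IsHomogeneous n → g ∈ I) : I = ⊤ := by
  obtain ⟨N, hN⟩ := h
  have key : ∀ j n, N ≤ n + j → ∀ g : MvPolynomial (Fin 3) k, g.IsHomogeneous n → g ∈ I := by
    intro j
    induction j with
    | zero => exact hN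
    | succ j ih =>
      intro n hn g hg
      refine hs g fun i => ih (n + 1) (by omega) _ ?_
      rw [add_comm]
      exact (isHomogeneous_X k i).mul hg
  exact (Ideal.eq_top_iff_one I).mpr (key N 0 (by omega) 1 (isHomogeneous_one _ _))

theorem height_eq_two {I : Ideal (MvPolynomial (Fin 3) k)} (hI : IsHomogeneousIdeal I)
    (hs : IsSaturated I) {w : Fin 3 → MvPolynomial (Fin 3) k} (hw : IsPrimitiveVec w)
    (hwI : ∀ i, w i ∈ I) (htop : I ≠ ⊤) : I.height = 2 := by
  refine le_antisymm ?_ ?_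
  · by_contra! hlt
    refine htop (hs.eq_top (hI.exists_forall_mem fun Q hQ hIQ => isMaximal_of_three_le_height ?_))
    exact (Order.add_one_le_of_lt hlt).trans (Ideal.height_mono hIQ)
  · rw [Ideal.height_eq_inf_minimalPrimes]
    refine le_iInf₂ fun P hP => ?_
    have := hP.1.1
    exact two_le_height_of_isPrimitiveVec hw fun i => hP.1.2 (hwI i)

end Height

/-! ### Hilbert functions -/

section Hilbert

variable {k : Type*} [Field k]

instance finite_homogeneousSubmodule (n : ℕ) :
    Module.Finite k (homogeneousSubmodule (Fin 3) k n) :=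
  Module.Finite.iff_fg.mpr (homogeneousSubmodule_fg (Fin 3) k n)

/-- The degree `n` part of `R/I`. -/
noncomputable abbrev quotientPart (I : Ideal (MvPolynomial (Fin 3) k)) (n : ℕ) :
    Submodule k (MvPolynomial (Fin 3) k ⧸ I) :=
  (homogeneousSubmodule (Fin 3) k n).map (Ideal.Quotient.mkₐ k I).toLinearMap

theorem mk_mem_quotientPart (I : Ideal (MvPolynomial (Fin 3) k)) {n : ℕ}
    {g : MvPolynomial (Fin 3) k} (hg : g.IsHomogeneous n) :
    Ideal.Quotient.mk I g ∈ quotientPart I n :=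
  ⟨g, hg, rfl⟩

theorem hilbertFunction_top (n : ℕ) :
    hilbertFunction (⊤ : Ideal (MvPolynomial (Fin 3) k)) n = 0 := by
  have := Ideal.Quotient.subsingleton_iff.mpr (rfl : (⊤ : Ideal (MvPolynomial (Fin 3) k)) = ⊤)
  exact Module.finrank_zero_of_subsingleton

theorem hilbertFunction_zero_pos {I : Ideal (MvPolynomial (Fin 3) k)} (h : I ≠ ⊤) :
    1 ≤ hilbertFunction I 0 := by
  have h1 : Ideal.Quotient.mk I 1 ≠ 0 := by
    rwa [Ne, Ideal.Quotient.eq_zero_iff_mem, ← Ideal.eq_top_iff_one]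
  have : Nontrivial (quotientPart I 0) :=
    ⟨⟨⟨_, mk_mem_quotientPart I (isHomogeneous_one _ _)⟩, 0,
      fun h2 => h1 (congrArg Subtype.val h2)⟩⟩
  exact Nat.one_le_iff_ne_zero.mpr (Module.finrank_pos (R := k) (M := quotientPart I 0)).ne'

theorem HasDegree.unique {I J : Ideal (MvPolynomial (Fin 3) k)} {a b : ℕ} (hI : HasDegree I a)
    (hJ : HasDegree J b) (h : hilbertFunction I = hilbertFunction J) : a = b := by
  obtain ⟨P, hP, ha⟩ := hI
  obtain ⟨Q, hQ, hb⟩ := hJ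
  have hPQ : P = Q := by
    refine Polynomial.eq_of_infinite_eval_eq P Q ?_
    obtain ⟨N, hN⟩ := Filter.eventually_atTop.mp (hP.and hQ)
    refine ((Set.Ici_infinite N).image (Nat.cast_injective (R := ℚ)).injOn).mono ?_
    rintro _ ⟨n, hn, rfl⟩
    obtain ⟨h1, h2⟩ := hN n hn
    rw [h] at h1
    exact h1.symm.trans h2
  subst hPQ
  exact_mod_cast ha.trans hb.symm

theorem hasDegree_top : HasDegree (⊤ : Ideal (MvPolynomial (Fin 3) k)) 0 := by
  refine ⟨0, Filter.Eventually.of_forall fun n => ?_, by simp⟩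
  simp [hilbertFunction_top]

theorem hasDegree_of_forall_eq {I : Ideal (MvPolynomial (Fin 3) k)} {N c : ℕ} (hc : c ≠ 0)
    (h : ∀ n, N ≤ n → hilbertFunction I n = c) : HasDegree I c := by
  have hc' : (c : ℚ) ≠ 0 := Nat.cast_ne_zero.mpr hc
  let S := ∑ i ∈ Finset.range N, hilbertFunction I i
  refine ⟨Polynomial.C (c : ℚ) * Polynomial.X + Polynomial.C ((S : ℚ) - c * N), ?_, ?_⟩
  · filter_upwards [Filter.eventually_ge_atTop N] with n hn
    have h1 : ∑ i ∈ Finset.range n, hilbertFunction I i = S + (n - N) * c := by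
      rw [← Finset.sum_range_add_sum_Ico _ hn,
        Finset.sum_congr rfl fun i hi => h i (Finset.mem_Ico.mp hi).1]
      simp [S]
    rw [h1]
    push_cast [hn]
    simp only [Polynomial.eval_add, Polynomial.eval_mul, Polynomial.eval_C, Polynomial.eval_X]
    ring
  · rw [Polynomial.natDegree_linear hc', Polynomial.leadingCoeff_linear hc']
    simp

/-- A saturated ideal has a linear nonzerodivisor on its quotient: the associated primes of `R/I`
are finitely many and none contains all linear forms. -/
theorem IsSaturated.exists_linear_regular [Infinite k] {I : Ideal (MvPolynomial (Fin 3) k)}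
    (hs : IsSaturated I) : ∃ l : MvPolynomial (Fin 3) k, l.IsHomogeneous 1 ∧
      ∀ P ∈ associatedPrimes (MvPolynomial (Fin 3) k) (MvPolynomial (Fin 3) k ⧸ I), l ∉ P := by
  classical
  have hfin := associatedPrimes.finite (MvPolynomial (Fin 3) k) (MvPolynomial (Fin 3) k ⧸ I)
  let F : Ideal (MvPolynomial (Fin 3) k) → Submodule k (homogeneousSubmodule (Fin 3) k 1) :=
    fun P => (P.restrictScalars k).comap (homogeneousSubmodule (Fin 3) k 1).subtype
  have htop : ⊤ ∉ hfin.toFinset.image F := by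
    intro hmem
    obtain ⟨P, hP, hPF⟩ := Finset.mem_image.mp hmem
    rw [Set.Finite.mem_toFinset] at hP
    have hX : ∀ i, X i ∈ P := fun i => by
      have : (⟨X i, isHomogeneous_X k i⟩ : homogeneousSubmodule (Fin 3) k 1) ∈ F P := by
        rw [hPF]; trivial
      exact this
    obtain ⟨hPp, x, hx⟩ := Submodule.isAssociatedPrime_iff.mp hP
    obtain ⟨g, rfl⟩ := Ideal.Quotient.mk_surjective x
    have hg : g ∈ I := hs g fun i => by
      have h1 := hX i
      rw [hx, Submodule.mem_colon_singleton, Submodule.mem_bot] at h1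
      exact Ideal.Quotient.eq_zero_iff_mem.mp h1
    refine hPp.ne_top ((Ideal.eq_top_iff_one P).mpr ?_)
    rw [hx, Submodule.mem_colon_singleton, Submodule.mem_bot,
      Ideal.Quotient.eq_zero_iff_mem.mpr hg, smul_zero]
  have hne := Subspace.biUnion_ne_univ_of_top_notMem htop
  obtain ⟨l, hl⟩ := (Set.ne_univ_iff_exists_notMem _).mp hne
  refine ⟨l, l.2, fun P hP hlP => hl ?_⟩
  exact Set.mem_biUnion (Finset.mem_image_of_mem F (hfin.mem_toFinset.mpr hP)) hlP

theorem isSMulRegular_of_forall_notMem {I : Ideal (MvPolynomial (Fin 3) k)}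
    {l : MvPolynomial (Fin 3) k}
    (h : ∀ P ∈ associatedPrimes (MvPolynomial (Fin 3) k) (MvPolynomial (Fin 3) k ⧸ I), l ∉ P) :
    IsSMulRegular (MvPolynomial (Fin 3) k ⧸ I) l := by
  by_contra hl
  have h1 : l ∈ {r | IsSMulRegular (MvPolynomial (Fin 3) k ⧸ I) r}ᶜ := hl
  rw [← biUnion_associatedPrimes_eq_compl_regular] at h1
  obtain ⟨P, hP, hlP⟩ := Set.mem_iUnion₂.mp h1
  exact h P hP hlP

theorem IsHomogeneousIdeal.sup_span_singleton {I : Ideal (MvPolynomial (Fin 3) k)}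
    (hI : IsHomogeneousIdeal I) {l : MvPolynomial (Fin 3) k} (hl : l.IsHomogeneous 1) :
    IsHomogeneousIdeal (I ⊔ Ideal.span {l}) := by
  intro g hg n
  obtain ⟨a, ha, b, hb, rfl⟩ := Submodule.mem_sup.mp hg
  obtain ⟨b, rfl⟩ := Ideal.mem_span_singleton'.mp hb
  rw [map_add]
  refine Submodule.add_mem_sup (hI a ha n) ?_
  cases n with
  | zero =>
    rw [homogeneousComponent_mul_of_lt hl b zero_lt_one]
    exact Ideal.zero_mem _
  | succ n =>
    rw [homogeneousComponent_add_mul hl]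
    exact Ideal.mul_mem_left _ _ (Ideal.mem_span_singleton_self l)

/-- Multiplication by a regular linear form `l` is injective on `R/I`, and in large degrees it is
surjective since `R/(I, l)` has finite length when `I` has codimension at least two. -/
theorem hilbertFunction_monotone_and_eventually_const [Infinite k]
    {I : Ideal (MvPolynomial (Fin 3) k)} (hI : IsHomogeneousIdeal I) (hs : IsSaturated I)
    (h2 : ∀ P : Ideal (MvPolynomial (Fin 3) k), P.IsPrime → I ≤ P → 2 ≤ P.height) :
    Monotone (hilbertFunction I) ∧
      ∃ N, ∀ n, N ≤ n → hilbertFunction I n = hilbertFunction I N := by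
  obtain ⟨l, hl, hass⟩ := hs.exists_linear_regular
  have hreg := isSMulRegular_of_forall_notMem hass
  have hmax : ∀ Q : Ideal (MvPolynomial (Fin 3) k), Q.IsPrime → I ⊔ Ideal.span {l} ≤ Q →
      Q.IsMaximal := by
    intro Q hQ hle
    obtain ⟨P, hP, hPQ⟩ := Ideal.exists_minimalPrimes_le (le_sup_left.trans hle)
    have hPp := hP.1.1
    -- `P` is a minimal prime of `I`, hence associated to `R/I`.
    have hlP : l ∉ P := by
      refine hass P
        (Module.associatedPrimes.minimalPrimes_annihilator_subset_associatedPrimes _ _ ?_)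
      rwa [Ideal.annihilator_quotient]
    have hlt : P < Q := lt_of_le_of_ne hPQ fun heq =>
      hlP (heq ▸ hle (Ideal.mem_sup_right (Ideal.mem_span_singleton_self l)))
    refine isMaximal_of_three_le_height ?_
    calc (3 : ℕ∞) = 2 + 1 := by norm_num
      _ ≤ P.height + 1 := add_le_add_left (h2 P hPp hP.1.2) 1
      _ ≤ Q.height := Ideal.height_add_one_le_of_lt_of_isPrime hlt
  obtain ⟨N, hN⟩ := (hI.sup_span_singleton hl).exists_forall_mem hmax
  let μ : (MvPolynomial (Fin 3) k ⧸ I) →ₗ[k] (MvPolynomial (Fin 3) k ⧸ I) :=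
    LinearMap.mulLeft k (Ideal.Quotient.mk I l)
  have hμ : Function.Injective μ := hreg
  have hmap : ∀ n, hilbertFunction I n = Module.finrank k ((quotientPart I n).map μ) := fun n =>
    (Submodule.equivMapOfInjective μ hμ _).finrank_eq
  have hle : ∀ n, (quotientPart I n).map μ ≤ quotientPart I (n + 1) := by
    rintro n _ ⟨_, ⟨g, hg, rfl⟩, rfl⟩
    refine ⟨l * g, ?_, map_mul (Ideal.Quotient.mk I) l g⟩
    rw [add_comm]
    exact hl.mul hg
  have hge : ∀ n, N ≤ n → quotientPart I (n + 1) ≤ (quotientPart I n).map μ := by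
    rintro n hn _ ⟨g, hg, rfl⟩
    obtain ⟨a, ha, b, hb, hab⟩ := Submodule.mem_sup.mp (hN (n + 1) (by omega) g hg)
    obtain ⟨b, rfl⟩ := Ideal.mem_span_singleton'.mp hb
    refine ⟨_, mk_mem_quotientPart I (homogeneousComponent_isHomogeneous n b), ?_⟩
    have h3 := congrArg (homogeneousComponent (n + 1)) hab
    rw [map_add, homogeneousComponent_add_mul hl, homogeneousComponent_of_mem hg,
      if_pos rfl] at h3
    change Ideal.Quotient.mk I l * Ideal.Quotient.mk I _ = Ideal.Quotient.mk I g
    rw [← map_mul, Ideal.Quotient.mk_eq_mk_iff_sub_mem, ← h3]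
    have := I.neg_mem (hI a ha (n + 1))
    convert this using 1
    ring
  refine ⟨monotone_nat_of_le_succ fun n => ?_, N, fun n hn => ?_⟩
  · rw [hmap n]
    exact Submodule.finrank_mono (hle n)
  · induction n, hn using Nat.le_induction with
    | base => rfl
    | succ n hn ih =>
      rw [← ih, hmap n, le_antisymm (hle n) (hge n hn)]
      rfl

end Hilbert

/-! ### The Hilbert function of a Bourbaki ideal -/

section BourbakiHilbert

variable {k : Type*} [Field k] {f : MvPolynomial (Fin 3) k} {d e : ℕ}

/-- Rank-nullity for the restriction of a linear map to a subspace. -/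
theorem finrank_map_add_finrank_inf_ker {V W : Type*} [AddCommGroup V] [Module k V]
    [AddCommGroup W] [Module k W] (φ : V →ₗ[k] W) (U : Submodule k V) [Module.Finite k U] :
    Module.finrank k (U.map φ) + Module.finrank k ↥(U ⊓ LinearMap.ker φ) = Module.finrank k U := by
  rw [← (φ.domRestrict U).finrank_range_add_finrank_ker, LinearMap.range_domRestrict,
    LinearMap.ker_domRestrict, ← Submodule.finrank_map_subtype_eq U, Submodule.map_comap_subtype]

/-- The homogeneous component of degree `n` of a syzygy. -/
noncomputable def syzComponent (hf : f.IsHomogeneous (d + 1)) (n : ℕ) (s : syz f) : syz f :=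
  ⟨_, vecComponent_mem_syz hf s.2 n⟩

theorem isHomogeneousVec_syzComponent (hf : f.IsHomogeneous (d + 1)) (n : ℕ) (s : syz f) :
    IsHomogeneousVec (syzComponent hf n s : Fin 3 → MvPolynomial (Fin 3) k) n :=
  fun _ => homogeneousComponent_isHomogeneous _ _

theorem exists_sum_syzComponent (hf : f.IsHomogeneous (d + 1)) (s : syz f) :
    ∃ N, ∀ M, N ≤ M → s = ∑ i ∈ Finset.range M, syzComponent hf i s := by
  refine ⟨∑ i, (s.1 i).totalDegree + 1, fun M hM => Subtype.ext (funext fun i => ?_)⟩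
  rw [Submodule.coe_sum, Finset.sum_apply]
  have hi : (s.1 i).totalDegree + 1 ≤ M :=
    (Nat.succ_le_succ (Finset.single_le_sum (f := fun i => (s.1 i).totalDegree)
      (fun _ _ => Nat.zero_le _) (Finset.mem_univ i))).trans hM
  conv_lhs => rw [← sum_homogeneousComponent (s.1 i)]
  refine Finset.sum_subset (Finset.range_subset_range.mpr hi) fun n _ hn => ?_
  refine homogeneousComponent_eq_zero n _ ?_
  rw [Finset.mem_range] at hn
  omega

variable {φ : syz f →ₗ[MvPolynomial (Fin 3) k] MvPolynomial (Fin 3) k}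

/-- A graded map on syzygies commutes with taking homogeneous components. -/
theorem IsGradedSyzMap.homogeneousComponent_apply (hφ : IsGradedSyzMap f d e φ)
    (hf : f.IsHomogeneous (d + 1)) (s : syz f) {m n : ℕ} (hmn : n + e = m + d) :
    homogeneousComponent m (φ s) = φ (syzComponent hf n s) := by
  obtain ⟨N, hN⟩ := exists_sum_syzComponent hf s
  conv_lhs => rw [hN (max N (n + 1)) (le_max_left _ _), map_sum, map_sum]
  rw [Finset.sum_eq_single_of_mem n
    (Finset.mem_range.mpr ((Nat.lt_succ_self n).trans_le (le_max_right _ _)))]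
  · rcases hφ n _ (isHomogeneousVec_syzComponent hf n s) with h | ⟨m', h1, h2⟩
    · rw [h, map_zero]
    · obtain rfl : m' = m := by omega
      rw [homogeneousComponent_of_mem h2, if_pos rfl]
  · intro i _ hi
    rcases hφ i _ (isHomogeneousVec_syzComponent hf i s) with h | ⟨m', h1, h2⟩
    · rw [h, map_zero]
    · exact homogeneousComponent_of_isHomogeneous_ne h2 (by omega)

theorem IsGradedSyzMap.isHomogeneousIdeal_range (hφ : IsGradedSyzMap f d e φ)
    (hf : f.IsHomogeneous (d + 1)) (hed : e ≤ d) :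
    IsHomogeneousIdeal (LinearMap.range φ : Ideal (MvPolynomial (Fin 3) k)) := by
  rintro _ ⟨s, rfl⟩ m
  exact ⟨_, (hφ.homogeneousComponent_apply hf s (n := m + (d - e)) (by omega)).symm⟩

theorem IsGradedSyzMap.exists_homogeneous_preimage (hφ : IsGradedSyzMap f d e φ)
    (hf : f.IsHomogeneous (d + 1)) {g : MvPolynomial (Fin 3) k} (hg : g ∈ LinearMap.range φ)
    {m n : ℕ} (hgm : g.IsHomogeneous m) (hmn : n + e = m + d) :
    ∃ s : syz f, IsHomogeneousVec (s : Fin 3 → MvPolynomial (Fin 3) k) n ∧ φ s = g := by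
  obtain ⟨s, rfl⟩ := hg
  refine ⟨_, isHomogeneousVec_syzComponent hf n s, ?_⟩
  rw [← hφ.homogeneousComponent_apply hf s hmn, homogeneousComponent_of_mem hgm, if_pos rfl]

/-- The homogeneous syzygies of degree `n`. -/
noncomputable def syzPart (f : MvPolynomial (Fin 3) k) (n : ℕ) : Submodule k (syz f) where
  carrier := {s | IsHomogeneousVec (s : Fin 3 → MvPolynomial (Fin 3) k) n}
  add_mem' hs ht i := (hs i).add (ht i)
  zero_mem' _ := isHomogeneous_zero _ _ _
  smul_mem' c _ hs i := (homogeneousSubmodule (Fin 3) k n).smul_mem c (hs i)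

instance finite_syzPart (n : ℕ) : Module.Finite k (syzPart f n) := by
  let j : syzPart f n →ₗ[k] (Fin 3 → homogeneousSubmodule (Fin 3) k n) :=
    { toFun := fun s i => ⟨s.1.1 i, s.2 i⟩
      map_add' := fun _ _ => rfl
      map_smul' := fun _ _ => rfl }
  refine Module.Finite.of_injective j fun s t h => Subtype.ext (Subtype.ext (funext fun i => ?_))
  exact congrArg Subtype.val (congrFun h i)

/-- Additivity of dimensions along `0 → R(-e) → Syz(J_f) → I(e - d) → 0` and
`0 → I → R → R/I → 0`. -/
theorem IsGradedSyzMap.hilbertFunction_add (hφ : IsGradedSyzMap f d e φ)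
    (hf : f.IsHomogeneous (d + 1)) (hed : e ≤ d) {ε : syz f} (hε : ε ≠ 0)
    (hεh : IsHomogeneousVec (ε : Fin 3 → MvPolynomial (Fin 3) k) e)
    (hker : LinearMap.ker φ = Submodule.span (MvPolynomial (Fin 3) k) {ε}) (m : ℕ) :
    hilbertFunction (LinearMap.range φ) m + Module.finrank k (syzPart f (m + (d - e))) =
      Module.finrank k (homogeneousSubmodule (Fin 3) k m) +
        if e ≤ m + (d - e) then
          Module.finrank k (homogeneousSubmodule (Fin 3) k (m + (d - e) - e)) else 0 := by
  set n := m + (d - e) with hn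
  have h1 := finrank_map_add_finrank_inf_ker
    (Ideal.Quotient.mkₐ k (LinearMap.range φ)).toLinearMap (homogeneousSubmodule (Fin 3) k m)
  have h2 := finrank_map_add_finrank_inf_ker (φ.restrictScalars k) (syzPart f n)
  -- The degree `m` part of `I` is the image of the syzygies of degree `n = m + d - e`.
  have h3 : homogeneousSubmodule (Fin 3) k m ⊓
      LinearMap.ker (Ideal.Quotient.mkₐ k (LinearMap.range φ)).toLinearMap =
      (syzPart f n).map (φ.restrictScalars k) := by
    ext g
    constructor
    · rintro ⟨hg, hgI⟩
      have hgI' : g ∈ LinearMap.range φ := Ideal.Quotient.eq_zero_iff_mem.mp hgI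
      obtain ⟨s, hs, hsg⟩ := hφ.exists_homogeneous_preimage hf hgI' hg
        (show n + e = m + d by omega)
      exact ⟨s, hs, hsg⟩
    · rintro ⟨s, hs, rfl⟩
      refine ⟨?_, Ideal.Quotient.eq_zero_iff_mem.mpr ⟨s, rfl⟩⟩
      rcases hφ n s hs with h | ⟨m', h, h'⟩
      · change φ s ∈ _
        rw [h]
        exact Submodule.zero_mem _
      · obtain rfl : m' = m := by omega
        exact h'
  -- The syzygies of degree `n` in the kernel are the multiples of `ε` by forms of degree `n - e`.
  have h4 : Module.finrank k ↥(syzPart f n ⊓ LinearMap.ker (φ.restrictScalars k)) =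
      if e ≤ n then Module.finrank k (homogeneousSubmodule (Fin 3) k (n - e)) else 0 := by
    obtain ⟨j, hj⟩ : ∃ j, (ε : Fin 3 → MvPolynomial (Fin 3) k) j ≠ 0 := by
      by_contra! h
      exact hε (Subtype.ext (funext h))
    have hsub : ∀ s ∈ syzPart f n ⊓ LinearMap.ker (φ.restrictScalars k),
        ∃ c : MvPolynomial (Fin 3) k, c • ε = s ∧
        (c ≠ 0 → ∃ m', m' + e = n ∧ c.IsHomogeneous m') := by
      rintro s ⟨hs, hsφ⟩
      have : s ∈ LinearMap.ker φ := hsφ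
      rw [hker, Submodule.mem_span_singleton] at this
      obtain ⟨c, rfl⟩ := this
      exact ⟨c, rfl, exists_isHomogeneous_of_mul (hεh j) hj (hs j)⟩
    split_ifs with hen
    · let ψ : MvPolynomial (Fin 3) k →ₗ[k] syz f :=
        (LinearMap.toSpanSingleton (MvPolynomial (Fin 3) k) (syz f) ε).restrictScalars k
      have hψ : Function.Injective ψ := fun a b hab => smul_left_injective _ hε hab
      have heq : syzPart f n ⊓ LinearMap.ker (φ.restrictScalars k) =
          (homogeneousSubmodule (Fin 3) k (n - e)).map ψ := by
        ext s
        constructor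
        · intro hs
          obtain ⟨c, rfl, hc⟩ := hsub s hs
          refine ⟨c, ?_, rfl⟩
          by_cases hc0 : c = 0
          · rw [hc0]
            exact Submodule.zero_mem _
          · obtain ⟨m', hm', hcm⟩ := hc hc0
            obtain rfl : m' = n - e := by omega
            exact hcm
        · rintro ⟨c, hc, rfl⟩
          refine ⟨fun i => ?_, ?_⟩
          · have := IsHomogeneous.mul hc (hεh i)
            rwa [Nat.sub_add_cancel hen] at this
          · have : c • ε ∈ LinearMap.ker φ := by
              rw [hker]
              exact Submodule.smul_mem _ _ (Submodule.mem_span_singleton_self ε)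
            exact this
      rw [heq]
      exact (Submodule.equivMapOfInjective ψ hψ _).finrank_eq.symm
    · have heq : syzPart f n ⊓ LinearMap.ker (φ.restrictScalars k) = ⊥ := by
        refine (Submodule.eq_bot_iff _).mpr fun s hs => ?_
        obtain ⟨c, rfl, hc⟩ := hsub s hs
        by_cases hc0 : c = 0
        · rw [hc0, zero_smul]
        · obtain ⟨m', hm', -⟩ := hc hc0
          omega
      rw [heq, finrank_bot]
  rw [h3] at h1
  rw [h4] at h2
  have h5 : hilbertFunction (LinearMap.range φ) m = Module.finrank k
    ((homogeneousSubmodule (Fin 3) k m).map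
      (Ideal.Quotient.mkₐ k (LinearMap.range φ)).toLinearMap) := rfl
  omega

end BourbakiHilbert

/-! ### Ideals generated by two independent linear forms -/

section Linear

variable {k : Type*} [Field k]

/-- The linear form with coefficient vector `a`. -/
noncomputable def linearForm (a : Fin 3 → k) : MvPolynomial (Fin 3) k :=
  ∑ i, C (a i) * X i

theorem linearForm_isHomogeneous (a : Fin 3 → k) : (linearForm a).IsHomogeneous 1 :=
  IsHomogeneous.sum _ _ _ fun i _ => isHomogeneous_C_mul_X (a i) i

theorem eval_linearForm (a p : Fin 3 → k) : eval p (linearForm a) = a ⬝ᵥ p := by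
  simp [linearForm, dotProduct]

theorem isHomogeneous_one_eq_linearForm {l : MvPolynomial (Fin 3) k} (hl : l.IsHomogeneous 1) :
    ∃ a, l = linearForm a := by
  have h1 : l ∈ homogeneousSubmodule (Fin 3) k 1 := hl
  rw [homogeneousSubmodule_one_eq_span_X, Submodule.mem_span_range_iff_exists_fun] at h1
  obtain ⟨a, rfl⟩ := h1
  exact ⟨a, Finset.sum_congr rfl fun i _ => smul_eq_C_mul _ _⟩

theorem aeval_mul_of_isHomogeneous {A : Type*} [CommRing A] [Algebra k A]
    {g : MvPolynomial (Fin 3) k} {n : ℕ} (hg : g.IsHomogeneous n) (c : A) (x : Fin 3 → A) :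
    aeval (fun i => c * x i) g = c ^ n * aeval x g := by
  rw [aeval_def, aeval_def, eval₂_eq', eval₂_eq', Finset.mul_sum]
  refine Finset.sum_congr rfl fun m hm => ?_
  simp_rw [mul_pow]
  rw [Finset.prod_mul_distrib, Finset.prod_pow_eq_pow_sum, ← Finsupp.degree_eq_sum,
    show m.degree = n from (hg.degree_eq_sum_deg_support hm).symm]
  ring

/-- Modulo an ideal containing the linear forms vanishing at a point `p`, a form is determined by
its value at `p`: as `p j * x i ≡ x j * p i`, a form `g` of degree `n` satisfies
`p j ^ n * g = g(p j * x) ≡ g(x j * p) = x j ^ n * g(p)`. -/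
theorem pow_mul_sub_mem {I : Ideal (MvPolynomial (Fin 3) k)} {p : Fin 3 → k}
    (h : ∀ i j, C (p i) * X j - C (p j) * X i ∈ I) {g : MvPolynomial (Fin 3) k} {n : ℕ}
    (hg : g.IsHomogeneous n) (j : Fin 3) :
    C (p j ^ n) * g - C (eval p g) * X j ^ n ∈ I := by
  rw [← Ideal.Quotient.mk_eq_mk_iff_sub_mem]
  let π : MvPolynomial (Fin 3) k →ₐ[k] MvPolynomial (Fin 3) k ⧸ I := Ideal.Quotient.mkₐ k I
  change π _ = π _
  have hC : ∀ c : k, π (C c) = algebraMap k _ c := fun c => π.commutes c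
  have h1 := aeval_mul_of_isHomogeneous hg (algebraMap k _ (p j)) fun i => π (X i)
  have h2 := aeval_mul_of_isHomogeneous hg (π (X j)) fun i => algebraMap k _ (p i)
  have h3 : (fun i => algebraMap k (MvPolynomial (Fin 3) k ⧸ I) (p j) * π (X i)) =
      fun i => π (X j) * algebraMap k _ (p i) := by
    funext i
    rw [← hC, ← hC, mul_comm (π (X j)), ← map_mul, ← map_mul]
    exact Ideal.Quotient.mk_eq_mk_iff_sub_mem _ _ |>.mpr (h j i)
  have h4 : aeval (fun i => π (X i)) g = π g := by
    conv_rhs => rw [← aeval_X_left_apply (R := k) g]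
    rw [← comp_aeval_apply]
  have h5 : aeval (fun i => algebraMap k (MvPolynomial (Fin 3) k ⧸ I) (p i)) g =
      algebraMap k _ (eval p g) := by
    rw [← coe_aeval_eq_eval]
    exact aeval_algebraMap_apply _ p g
  rw [h3, h2, h4, h5] at h1
  rw [map_mul, map_mul, hC, hC, map_pow, map_pow, ← h1]
  ring

theorem mem_of_eval_eq_zero {I : Ideal (MvPolynomial (Fin 3) k)} {p : Fin 3 → k} (hp : p ≠ 0)
    (h : ∀ i j, C (p i) * X j - C (p j) * X i ∈ I) {g : MvPolynomial (Fin 3) k} {n : ℕ}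
    (hg : g.IsHomogeneous n) (h0 : eval p g = 0) : g ∈ I := by
  obtain ⟨j, hj⟩ := Function.ne_iff.mp hp
  have h1 := pow_mul_sub_mem h hg j
  rw [h0, C_0, zero_mul, sub_zero] at h1
  exact (Ideal.unit_mul_mem_iff_mem I ((IsUnit.mk0 _ (pow_ne_zero n hj)).map C)).mp h1

theorem cross_cross_eq_zero {A : Type*} [CommRing A] {a b x : Fin 3 → A} (ha : a ⬝ᵥ x = 0)
    (hb : b ⬝ᵥ x = 0) : a ⨯₃ b ⨯₃ x = 0 := by
  rw [cross_cross_eq_smul_sub_smul, ha, hb, zero_smul, zero_smul, sub_zero]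

theorem C_mul_X_sub_mem {I : Ideal (MvPolynomial (Fin 3) k)} {a b : Fin 3 → k}
    (ha : linearForm a ∈ I) (hb : linearForm b ∈ I) (i j : Fin 3) :
    C ((a ⨯₃ b) i) * X j - C ((a ⨯₃ b) j) * X i ∈ I := by
  rw [← Ideal.Quotient.mk_eq_mk_iff_sub_mem, map_mul, map_mul]
  let x : Fin 3 → MvPolynomial (Fin 3) k ⧸ I := fun i => Ideal.Quotient.mk I (X i)
  let c : (Fin 3 → k) → Fin 3 → MvPolynomial (Fin 3) k ⧸ I :=
    fun a i => Ideal.Quotient.mk I (C (a i))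
  have hdot : ∀ a, linearForm a ∈ I → c a ⬝ᵥ x = 0 := by
    intro a ha
    rw [← Ideal.Quotient.eq_zero_iff_mem, linearForm, map_sum] at ha
    rw [← ha]
    exact Finset.sum_congr rfl fun i _ => (map_mul _ _ _).symm
  have hcross : c (a ⨯₃ b) = c a ⨯₃ c b := by
    funext i
    fin_cases i <;> simp [c, cross_apply]
  have h1 : c (a ⨯₃ b) ⨯₃ x = 0 := by
    rw [hcross]
    exact cross_cross_eq_zero (hdot a ha) (hdot b hb)
  exact cross_eq_zero_iff.mp h1 i j

theorem eval_eq_zero_of_mem {a b : Fin 3 → k} {g : MvPolynomial (Fin 3) k}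
    (hg : g ∈ Ideal.span {linearForm a, linearForm b}) : eval (a ⨯₃ b) g = 0 := by
  obtain ⟨x, y, rfl⟩ := Ideal.mem_span_pair.mp hg
  rw [map_add, map_mul, map_mul, eval_linearForm, eval_linearForm, dot_self_cross, dot_cross_self,
    mul_zero, mul_zero, add_zero]

theorem hilbertFunction_span_linearForm {a b : Fin 3 → k} (hab : a ⨯₃ b ≠ 0) (n : ℕ) :
    hilbertFunction (Ideal.span {linearForm a, linearForm b}) n = 1 := by
  set I := Ideal.span {linearForm a, linearForm b} with hI
  set p := a ⨯₃ b with hp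
  have h : ∀ i j, C (p i) * X j - C (p j) * X i ∈ I :=
    C_mul_X_sub_mem (Ideal.subset_span (by simp)) (Ideal.subset_span (by simp))
  obtain ⟨j, hj⟩ := Function.ne_iff.mp hab
  have hjn : p j ^ n ≠ 0 := pow_ne_zero n hj
  have hX := isHomogeneous_X_pow (R := k) j n
  refine finrank_eq_one (⟨_, mk_mem_quotientPart I hX⟩ : quotientPart I n) ?_ ?_
  · intro h0
    have h1 := eval_eq_zero_of_mem (Ideal.Quotient.eq_zero_iff_mem.mp (congrArg Subtype.val h0))
    rw [map_pow, eval_X] at h1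
    exact hjn h1
  · rintro ⟨_, g, hg, rfl⟩
    refine ⟨(p j ^ n)⁻¹ * eval p g, Subtype.ext ?_⟩
    have h1 := pow_mul_sub_mem h hg j
    rw [← Ideal.Quotient.mk_eq_mk_iff_sub_mem] at h1
    change Ideal.Quotient.mk I (((p j ^ n)⁻¹ * eval p g) • X j ^ n) = Ideal.Quotient.mk I g
    rw [smul_eq_C_mul, C_mul, mul_assoc, map_mul, ← h1, ← map_mul, ← mul_assoc, ← C_mul,
      inv_mul_cancel₀ hjn, C_1, one_mul]

theorem exists_cross_eq {p : Fin 3 → k} (hp : p ≠ 0) : ∃ a b : Fin 3 → k, a ⨯₃ b = p := by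
  obtain ⟨j, hj⟩ := Function.ne_iff.mp hp
  rw [Pi.zero_apply] at hj
  fin_cases j
  · refine ⟨(p 0)⁻¹ • ![-p 1, p 0, 0], ![-p 2, 0, p 0], ?_⟩
    simp only [Fin.zero_eta] at hj
    ext i
    fin_cases i <;> simp [cross_apply] <;> field_simp
  · refine ⟨(p 1)⁻¹ • ![0, -p 2, p 1], ![p 1, -p 0, 0], ?_⟩
    simp only [Fin.mk_one] at hj
    ext i
    fin_cases i <;> simp [cross_apply] <;> field_simp
  · refine ⟨(p 2)⁻¹ • ![p 2, 0, -p 0], ![0, p 2, -p 1], ?_⟩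
    simp only [Fin.reduceFinMk] at hj
    ext i
    fin_cases i <;> simp [cross_apply] <;> field_simp

/-- A homogeneous ideal whose quotient has Hilbert function `1` is the ideal of a point. -/
theorem IsHomogeneousIdeal.eq_span_linearForm {I : Ideal (MvPolynomial (Fin 3) k)}
    (hI : IsHomogeneousIdeal I) (h : ∀ n, hilbertFunction I n = 1) :
    ∃ a b, a ⨯₃ b ≠ 0 ∧ I = Ideal.span {linearForm a, linearForm b} := by
  obtain ⟨v, -, hv⟩ := finrank_eq_one_iff'.mp (h 1)
  choose p hp using fun i => hv ⟨_, mk_mem_quotientPart I (isHomogeneous_X k i)⟩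
  have hp' : ∀ i, p i • (v : MvPolynomial (Fin 3) k ⧸ I) = Ideal.Quotient.mk I (X i) :=
    fun i => congrArg Subtype.val (hp i)
  have hlin : ∀ a, Ideal.Quotient.mk I (linearForm a) =
      (a ⬝ᵥ p) • (v : MvPolynomial (Fin 3) k ⧸ I) := by
    intro a
    rw [linearForm, map_sum, dotProduct, Finset.sum_smul]
    refine Finset.sum_congr rfl fun i _ => ?_
    rw [mul_smul, hp', ← smul_eq_C_mul]
    rfl
  have hbot : ∀ n, quotientPart I n ≠ ⊥ := by
    intro n h0
    have := h n
    change Module.finrank k (quotientPart I n) = 1 at this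
    rw [h0, finrank_bot] at this
    exact zero_ne_one this
  have hp0 : p ≠ 0 := by
    rintro rfl
    refine hbot 1 ((Submodule.eq_bot_iff _).mpr ?_)
    rintro _ ⟨g, hg, rfl⟩
    obtain ⟨a, rfl⟩ := isHomogeneous_one_eq_linearForm hg
    refine (hlin a).trans ?_
    rw [dotProduct_zero, zero_smul]
  obtain ⟨a, b, rfl⟩ := exists_cross_eq hp0
  have hle : Ideal.span {linearForm a, linearForm b} ≤ I := by
    rw [Ideal.span_le]
    rintro _ (rfl | rfl)
    · refine Ideal.Quotient.eq_zero_iff_mem.mp ((hlin a).trans ?_)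
      rw [dot_self_cross, zero_smul]
    · refine Ideal.Quotient.eq_zero_iff_mem.mp ((hlin b).trans ?_)
      rw [dot_cross_self, zero_smul]
  refine ⟨a, b, hp0, le_antisymm (fun g hg => ?_) hle⟩
  have hL : ∀ i j, C ((a ⨯₃ b) i) * X j - C ((a ⨯₃ b) j) * X i ∈
      Ideal.span {linearForm a, linearForm b} :=
    C_mul_X_sub_mem (Ideal.subset_span (by simp)) (Ideal.subset_span (by simp))
  rw [← sum_homogeneousComponent g]
  refine Ideal.sum_mem _ fun n _ => ?_
  have hgn := homogeneousComponent_isHomogeneous n g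
  refine mem_of_eval_eq_zero hp0 hL hgn ?_
  -- A form in `I` not vanishing at the point would force `I` to contain all forms of its degree.
  by_contra hne
  refine hbot n ((Submodule.eq_bot_iff _).mpr ?_)
  rintro _ ⟨q, hq, rfl⟩
  refine Ideal.Quotient.eq_zero_iff_mem.mpr ?_
  have h1 : C (eval (a ⨯₃ b) (homogeneousComponent n g)) * q -
      C (eval (a ⨯₃ b) q) * homogeneousComponent n g ∈ I := by
    refine hle (mem_of_eval_eq_zero hp0 hL
      ((IsHomogeneous.C_mul hq _).sub (IsHomogeneous.C_mul hgn _)) ?_)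
    rw [map_sub, map_mul, map_mul, eval_C, eval_C, mul_comm, sub_self]
  have h2 := I.add_mem h1 (I.mul_mem_left (C (eval (a ⨯₃ b) q)) (hI g hg n))
  rw [sub_add_cancel] at h2
  exact (Ideal.unit_mul_mem_iff_mem I ((IsUnit.mk0 _ hne).map C)).mp h2

end Linear

/-! ### Bourbaki ideals -/

section Bourbaki

variable {k : Type*} [Field k] {f : MvPolynomial (Fin 3) k} {d e : ℕ}

/-- The standard Bourbaki ideal with respect to `ε`: the ideal of all `g` such that
`s × ε = g • ∇f` for a syzygy `s`. -/
theorem exists_isBourbakiIdeal (hf : f.IsHomogeneous (d + 1)) (hg : IsPrimitiveVec (grad f))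
    (he : IsInitialSyzygyDegree f e) {ε : syz f} (hε : ε ≠ 0)
    (hεh : IsHomogeneousVec (ε : Fin 3 → MvPolynomial (Fin 3) k) e) :
    ∃ φ : syz f →ₗ[MvPolynomial (Fin 3) k] MvPolynomial (Fin 3) k,
      LinearMap.ker φ = Submodule.span (MvPolynomial (Fin 3) k) {ε} ∧
      IsGradedSyzMap f d e φ ∧
      (∀ i, (ε : Fin 3 → MvPolynomial (Fin 3) k) i ∈ LinearMap.range φ) ∧
      IsBourbakiIdeal f d e ε (LinearMap.range φ) := by
  have hεp := isPrimitiveVec_of_isInitialSyzygyDegree hf he ε.2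
    (fun h => hε (Subtype.ext h)) hεh
  obtain ⟨φ, hφ⟩ := exists_isCrossMap hg ε.2
  have hker := hφ.ker_eq hg ε.2 hεp
  have hgr := hφ.isGradedSyzMap hf hg hεh
  have hmem := hφ.apply_mem_range hg ε.2
  have hhom := hgr.isHomogeneousIdeal_range hf (he.le hf hg)
  refine ⟨φ, hker, hgr, hmem, hhom, ?_, φ, hker, rfl, hgr⟩
  exact or_iff_not_imp_left.mpr (height_eq_two hhom (isSaturated_range hε hker) hεp hmem)

theorem hilbertFunction_eq_of_isBourbakiIdeal (hf : f.IsHomogeneous (d + 1)) (hed : e ≤ d)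
    {ε ε' : syz f} (hε : ε ≠ 0) (hε' : ε' ≠ 0)
    (hεh : IsHomogeneousVec (ε : Fin 3 → MvPolynomial (Fin 3) k) e)
    (hεh' : IsHomogeneousVec (ε' : Fin 3 → MvPolynomial (Fin 3) k) e)
    {I I' : Ideal (MvPolynomial (Fin 3) k)} (hI : IsBourbakiIdeal f d e ε I)
    (hI' : IsBourbakiIdeal f d e ε' I') : hilbertFunction I = hilbertFunction I' := by
  obtain ⟨-, -, φ, hker, rfl, hφ⟩ := hI
  obtain ⟨-, -, φ', hker', rfl, hφ'⟩ := hI'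
  funext m
  have h1 := IsGradedSyzMap.hilbertFunction_add hφ hf hed hε hεh hker m
  have h2 := IsGradedSyzMap.hilbertFunction_add hφ' hf hed hε' hεh' hker' m
  omega

theorem IsBourbakiDegree.unique (hf : f.IsHomogeneous (d + 1)) (hg : IsPrimitiveVec (grad f))
    {b b' : ℕ} (h : IsBourbakiDegree f d b) (h' : IsBourbakiDegree f d b') : b = b' := by
  obtain ⟨e, ε, I, he, hε, hεh, hI, hb⟩ := h
  obtain ⟨e', ε', I', he', hε', hεh', hI', hb'⟩ := h'
  obtain rfl := he.unique he'
  exact hb.unique hb'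
    (hilbertFunction_eq_of_isBourbakiIdeal hf (he.le hf hg) hε hε' hεh hεh' hI hI')

/-- The Hilbert function of `R/I` for a Bourbaki ideal `I ≠ R`: it does not decrease, and its
eventual value is the degree of `R/I`. -/
theorem IsBourbakiIdeal.exists_hasDegree [Infinite k] {ε : syz f} (hε : ε ≠ 0)
    {I : Ideal (MvPolynomial (Fin 3) k)} (hI : IsBourbakiIdeal f d e ε I) (htop : I ≠ ⊤) :
    ∃ c N, Monotone (hilbertFunction I) ∧ (∀ n, N ≤ n → hilbertFunction I n = c) ∧
      HasDegree I c := by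
  obtain ⟨hhom, hht, φ, hker, hrange, -⟩ := hI
  have hsat : IsSaturated I := hrange ▸ isSaturated_range hε hker
  obtain ⟨hmono, N, hN⟩ := hilbertFunction_monotone_and_eventually_const hhom hsat
    fun P _ hP => (hht.resolve_left htop) ▸ Ideal.height_mono hP
  refine ⟨_, N, hmono, hN, hasDegree_of_forall_eq ?_ hN⟩
  have := (hilbertFunction_zero_pos htop).trans (hmono (Nat.zero_le N))
  omega

theorem exists_isBourbakiDegree [Infinite k] (hf : f.IsHomogeneous (d + 1))
    (hg : IsPrimitiveVec (grad f)) : ∃ b, IsBourbakiDegree f d b := by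
  obtain ⟨e, he⟩ := exists_isInitialSyzygyDegree hf hg
  obtain ⟨s, hs, hs0, hsh⟩ := he.1
  have hε : (⟨s, hs⟩ : syz f) ≠ 0 := fun h => hs0 (congrArg Subtype.val h)
  obtain ⟨φ, -, -, -, hI⟩ := exists_isBourbakiIdeal hf hg he hε hsh
  by_cases htop : (LinearMap.range φ : Ideal (MvPolynomial (Fin 3) k)) = ⊤
  · exact ⟨0, e, _, _, he, hε, hsh, hI, htop ▸ hasDegree_top⟩
  · obtain ⟨c, N, -, -, hc⟩ := hI.exists_hasDegree hε htop
    exact ⟨c, e, _, _, he, hε, hsh, hI, hc⟩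

/-- If the Bourbaki degree is one, a Bourbaki ideal is the ideal of a point. -/
theorem IsBourbakiIdeal.eq_span_linearForm [Infinite k] {ε : syz f} (hε : ε ≠ 0)
    {I : Ideal (MvPolynomial (Fin 3) k)} (hI : IsBourbakiIdeal f d e ε I) (h1 : HasDegree I 1) :
    ∃ a b, a ⨯₃ b ≠ 0 ∧ I = Ideal.span {linearForm a, linearForm b} := by
  have htop : I ≠ ⊤ := by
    rintro rfl
    exact absurd (h1.unique hasDegree_top rfl) one_ne_zero
  obtain ⟨c, N, hmono, hN, hc⟩ := hI.exists_hasDegree hε htop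
  obtain rfl := h1.unique hc rfl
  refine IsHomogeneousIdeal.eq_span_linearForm hI.1 fun n => le_antisymm ?_ ?_
  · exact (hmono (le_max_left n N)).trans (hN _ (le_max_right n N)).le
  · exact (hilbertFunction_zero_pos htop).trans (hmono (Nat.zero_le n))

end Bourbaki

/-! ### From Bourbaki degree one to a resolution -/

section Resolution

variable {k : Type*} [Field k] {f : MvPolynomial (Fin 3) k} {d e : ℕ}

theorem constantCoeff_eq_zero_of_isHomogeneous {g : MvPolynomial (Fin 3) k} {n : ℕ}
    (hg : g.IsHomogeneous n) (hn : 1 ≤ n) : constantCoeff g = 0 := by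
  rw [constantCoeff_eq]
  exact hg.coeff_eq_zero (by rw [map_zero]; omega)

/-- A combination of vectors as the product with the matrix having these vectors as columns. -/
theorem sum_smul_eq_mulVec {A : Type*} [CommRing A] (s : Fin 3 → Fin 3 → A) (y : Fin 3 → A) :
    ∑ j, y j • s j = (Matrix.of fun i j => s j i) *ᵥ y := by
  funext i
  rw [Finset.sum_apply]
  exact Finset.sum_congr rfl fun j _ => mul_comm _ _

/-- Three syzygies of degrees `e ≤ n, n, n` generating `Syz(J_f)`, whose relations are generated by
one vector with entries of degree at least `1`, `1` and `1`, give the resolution of a nearly free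
curve. -/
theorem isNearlyFreeWithExponents_of_generators {n m : ℕ} (hd : 1 ≤ d)
    (hf : f.IsHomogeneous (d + 1)) (he1 : 1 ≤ e) (hen : e ≤ n)
    {s : Fin 3 → Fin 3 → MvPolynomial (Fin 3) k} {r : Fin 3 → MvPolynomial (Fin 3) k}
    (hs0 : IsHomogeneousVec (s 0) e) (hs1 : IsHomogeneousVec (s 1) n)
    (hs2 : IsHomogeneousVec (s 2) n)
    (hr0 : r 0 = 0 ∨ m + e = n + 1 ∧ (r 0).IsHomogeneous m)
    (hr1 : (r 1).IsHomogeneous 1) (hr2 : (r 2).IsHomogeneous 1) (hr : r ≠ 0)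
    (hsyz : ∀ v, v ∈ syz f ↔ ∃ y : Fin 3 → MvPolynomial (Fin 3) k, ∑ j, y j • s j = v)
    (hrel : ∀ y : Fin 3 → MvPolynomial (Fin 3) k, ∑ j, y j • s j = 0 ↔
      ∃ t : MvPolynomial (Fin 3) k, t • r = y) :
    IsNearlyFreeWithExponents f d e n := by
  refine ⟨he1, hen, Matrix.of fun _ i => grad f i, Matrix.of fun i j => s j i,
    Matrix.of fun i _ => r i, ?_, ?_, ?_, ?_, ?_, ?_, rfl, ?_, ?_, ?_⟩
  · intro _ j
    refine Or.inr ⟨d, ?_, grad_isHomogeneous hf j⟩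
    fin_cases j <;> simp
  · intro i j
    have hi : (![d, d, d] : Fin 3 → ℕ) i = d := by fin_cases i <;> rfl
    rw [hi]
    fin_cases j
    exacts [Or.inr ⟨e, rfl, hs0 i⟩, Or.inr ⟨n, rfl, hs1 i⟩, Or.inr ⟨n, rfl, hs2 i⟩]
  · intro i j
    obtain rfl : j = 0 := Subsingleton.elim _ _
    fin_cases i
    · refine hr0.imp id fun ⟨h1, h2⟩ => ⟨m, ?_, h2⟩
      change d + n + 1 = d + e + m
      omega
    · exact Or.inr ⟨1, rfl, hr1⟩
    · exact Or.inr ⟨1, rfl, hr2⟩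
  · intro _ j
    exact constantCoeff_eq_zero_of_isHomogeneous (grad_isHomogeneous hf j) hd
  · intro i j
    fin_cases j
    exacts [constantCoeff_eq_zero_of_isHomogeneous (hs0 i) he1,
      constantCoeff_eq_zero_of_isHomogeneous (hs1 i) (he1.trans hen),
      constantCoeff_eq_zero_of_isHomogeneous (hs2 i) (he1.trans hen)]
  · intro i _
    fin_cases i
    · rcases hr0 with h | ⟨h1, h2⟩
      · exact (congrArg constantCoeff h).trans (map_zero _)
      · exact constantCoeff_eq_zero_of_isHomogeneous h2 (by omega)
    · exact constantCoeff_eq_zero_of_isHomogeneous hr1 le_rfl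
    · exact constantCoeff_eq_zero_of_isHomogeneous hr2 le_rfl
  · intro v
    have h1 : (Matrix.of fun (_ : Fin 1) i => grad f i).mulVecLin v = 0 ↔ v ∈ syz f := by
      rw [mem_syz, dotProduct_comm]
      exact ⟨fun h => congrFun h 0, fun h => funext fun _ => h⟩
    rw [h1, hsyz, Set.mem_range]
    refine exists_congr fun y => ?_
    rw [sum_smul_eq_mulVec]
    rfl
  · intro y
    have h1 : (Matrix.of fun i j => s j i).mulVecLin y = ∑ j, y j • s j := by
      rw [sum_smul_eq_mulVec]
      rfl
    rw [h1, hrel, Set.mem_range]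
    constructor
    · rintro ⟨t, rfl⟩
      exact ⟨fun _ => t, funext fun i => by simp [Matrix.mulVec, dotProduct, mul_comm]⟩
    · rintro ⟨t, rfl⟩
      exact ⟨t 0, funext fun i => by simp [Matrix.mulVec, dotProduct, mul_comm]⟩
  · intro t t' h
    obtain ⟨i, hi⟩ := Function.ne_iff.mp hr
    have h1 := congrFun h i
    simp only [Matrix.mulVecLin_apply, Matrix.mulVec, dotProduct, Finset.univ_unique,
      Finset.sum_singleton, Matrix.of_apply] at h1
    funext j
    obtain rfl : j = default := Subsingleton.elim _ _
    exact mul_left_cancel₀ hi h1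

/-- If the Bourbaki ideal is generated by two linear forms, then `ε` and preimages of the linear
forms generate `Syz(J_f)`, and the only relation lifts the Koszul relation of the linear forms. -/
theorem isNearlyFree_of_isBourbakiDegree_one [Infinite k] (hd : 1 ≤ d)
    (hf : f.IsHomogeneous (d + 1)) (hg : IsPrimitiveVec (grad f)) (h : IsBourbakiDegree f d 1) :
    IsNearlyFree f d := by
  obtain ⟨e, ε, I, he, hε, hεh, hI, h1⟩ := h
  have hed := he.le hf hg
  have hε0 : (ε : Fin 3 → MvPolynomial (Fin 3) k) ≠ 0 := fun h => hε (Subtype.ext h)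
  have hεp := isPrimitiveVec_of_isInitialSyzygyDegree hf he ε.2 hε0 hεh
  obtain ⟨φ, hker, hgr, hmem, hB⟩ := exists_isBourbakiIdeal hf hg he hε hεh
  have h1' : HasDegree (LinearMap.range φ) 1 := by
    have := hilbertFunction_eq_of_isBourbakiIdeal hf hed hε hε hεh hεh hI hB
    rwa [HasDegree, this] at h1
  obtain ⟨a, b, hab, hspan⟩ := hB.eq_span_linearForm hε h1'
  have hla : linearForm a ∈ LinearMap.range φ := by
    rw [hspan]; exact Ideal.subset_span (by simp)
  have hlb : linearForm b ∈ LinearMap.range φ := by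
    rw [hspan]; exact Ideal.subset_span (by simp)
  have hprim : IsPrimitiveVec ![linearForm b, -linearForm a] := by
    intro h hh
    refine hεp h fun i => ?_
    have hi := hmem i
    rw [hspan] at hi
    obtain ⟨x, y, hxy⟩ := Ideal.mem_span_pair.mp hi
    rw [← hxy]
    exact dvd_add (((dvd_neg.mp (hh 1)).mul_left x)) ((hh 0).mul_left y)
  -- If `e = 0`, the coordinates of `ε` are constants lying in a proper ideal, hence zero.
  have he1 : 1 ≤ e := by
    by_contra hlt
    obtain rfl : e = 0 := by omega
    refine hε0 (funext fun i => ?_)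
    have hi := hmem i
    rw [hspan] at hi
    have h2 := eval_eq_zero_of_mem hi
    have h3 := totalDegree_eq_zero_iff_eq_C.mp (Nat.le_zero.mp (hεh i).totalDegree_le)
    rw [h3, eval_C] at h2
    rw [h3, h2, C_0, Pi.zero_apply]
  obtain ⟨s₁, hs₁, hφ₁⟩ := hgr.exists_homogeneous_preimage hf hla (linearForm_isHomogeneous a)
    (show d + 1 - e + e = 1 + d by omega)
  obtain ⟨s₂, hs₂, hφ₂⟩ := hgr.exists_homogeneous_preimage hf hlb (linearForm_isHomogeneous b)
    (show d + 1 - e + e = 1 + d by omega)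
  set n := d + 1 - e with hn
  have hen : e ≤ n := by
    by_cases h0 : (s₁ : Fin 3 → MvPolynomial (Fin 3) k) = 0
    · have h0' : s₁ = 0 := Subtype.ext h0
      have ha0 : linearForm a = 0 := by rw [← hφ₁, h0', map_zero]
      refine he.2 ⟨s₂, s₂.2, fun h2 => ?_, hs₂⟩
      have h2' : s₂ = 0 := Subtype.ext h2
      have hb0 : linearForm b = 0 := by rw [← hφ₂, h2', map_zero]
      obtain ⟨j, hj⟩ := hprim.exists_ne_zero
      fin_cases j <;> simp [ha0, hb0] at hj
    · exact he.2 ⟨s₁, s₁.2, h0, hs₁⟩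
  have hφε : φ ε = 0 := by
    rw [← LinearMap.mem_ker, hker]
    exact Submodule.mem_span_singleton_self ε
  obtain ⟨c, hc⟩ : ∃ c : MvPolynomial (Fin 3) k,
      c • ε = linearForm b • s₁ - linearForm a • s₂ := by
    rw [← Submodule.mem_span_singleton, ← hker, LinearMap.mem_ker, map_sub, map_smul, map_smul,
      hφ₁, hφ₂, smul_eq_mul, smul_eq_mul]
    ring
  have hc' : c = 0 ∨ ∃ m, m + e = n + 1 ∧ c.IsHomogeneous m := by
    obtain ⟨j, hj⟩ := Function.ne_iff.mp hε0
    refine or_iff_not_imp_left.mpr fun h0 => exists_isHomogeneous_of_mul (hεh j) hj ?_ h0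
    have h2 := congrFun (congrArg Subtype.val hc) j
    change c * (ε : Fin 3 → MvPolynomial (Fin 3) k) j =
      linearForm b * (s₁ : Fin 3 → MvPolynomial (Fin 3) k) j -
      linearForm a * (s₂ : Fin 3 → MvPolynomial (Fin 3) k) j at h2
    rw [h2, add_comm]
    exact ((linearForm_isHomogeneous b).mul (hs₁ j)).sub ((linearForm_isHomogeneous a).mul (hs₂ j))
  obtain ⟨m, hm⟩ : ∃ m, c = 0 ∨ m + e = n + 1 ∧ c.IsHomogeneous m := by
    rcases hc' with h0 | ⟨m, hm⟩
    exacts [⟨0, Or.inl h0⟩, ⟨m, Or.inr hm⟩]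
  have hcoe : ∀ y : Fin 3 → MvPolynomial (Fin 3) k,
      ∑ j, y j • (![ε.1, s₁.1, s₂.1] : Fin 3 → Fin 3 → MvPolynomial (Fin 3) k) j =
        ((y 0 • ε + y 1 • s₁ + y 2 • s₂ : syz f) : Fin 3 → MvPolynomial (Fin 3) k) := by
    intro y
    rw [Fin.sum_univ_three]
    rfl
  refine ⟨e, n, isNearlyFreeWithExponents_of_generators (m := m) hd hf he1 hen
    (s := ![ε.1, s₁.1, s₂.1]) (r := ![c, -linearForm b, linearForm a]) hεh hs₁ hs₂ hm
    (linearForm_isHomogeneous b).neg (linearForm_isHomogeneous a) ?_ ?_ ?_⟩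
  · intro h0
    have h2 : linearForm b = 0 := neg_eq_zero.mp (congrFun h0 1)
    have h3 : linearForm a = 0 := congrFun h0 2
    obtain ⟨j, hj⟩ := hprim.exists_ne_zero
    fin_cases j <;> simp [h2, h3] at hj
  · intro v
    constructor
    · intro hv
      have h2 : φ ⟨v, hv⟩ ∈ Ideal.span {linearForm a, linearForm b} := hspan ▸ ⟨_, rfl⟩
      obtain ⟨x, y, hxy⟩ := Ideal.mem_span_pair.mp h2
      obtain ⟨u, hu⟩ : ∃ u : MvPolynomial (Fin 3) k,
          u • ε = (⟨v, hv⟩ : syz f) - x • s₁ - y • s₂ := by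
        rw [← Submodule.mem_span_singleton, ← hker, LinearMap.mem_ker, map_sub, map_sub, map_smul,
          map_smul, hφ₁, hφ₂, ← hxy, smul_eq_mul, smul_eq_mul]
        ring
      have h3 : u • ε + x • s₁ + y • s₂ = (⟨v, hv⟩ : syz f) := by
        rw [hu]
        abel
      exact ⟨![u, x, y], (hcoe _).trans (congrArg Subtype.val h3)⟩
    · rintro ⟨y, rfl⟩
      rw [hcoe]
      exact Subtype.property _
  · intro y
    rw [hcoe, Submodule.coe_eq_zero]
    constructor
    · intro h0
      have h2 : y 1 * linearForm a + y 2 * linearForm b = 0 := by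
        have := congrArg φ h0
        rwa [map_add, map_add, map_smul, map_smul, map_smul, hφε, hφ₁, hφ₂, smul_zero, zero_add,
          map_zero, smul_eq_mul, smul_eq_mul] at this
      obtain ⟨t, ht⟩ := hprim.exists_smul_eq (a := ![y 1, y 2]) fun i j => by
        fin_cases i <;> fin_cases j <;>
          simp only [Fin.zero_eta, Fin.mk_one, Matrix.cons_val_zero, Matrix.cons_val_one] <;>
          first | rfl | linear_combination h2 | linear_combination -h2
      have ht1 : y 1 = t * linearForm b := congrFun ht 0
      have ht2 : y 2 = t * -linearForm a := congrFun ht 1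
      have h3 : (y 0 + t * c) • ε = 0 := by
        rw [add_smul, mul_smul, hc, ← h0, ht1, ht2]
        module
      have h4 := (smul_eq_zero.mp h3).resolve_right hε
      refine ⟨-t, funext fun i => ?_⟩
      fin_cases i
      · change -t * c = y 0
        linear_combination -h4
      · change -t * -linearForm b = y 1
        linear_combination -ht1
      · change -t * linearForm a = y 2
        linear_combination -ht2
    · rintro ⟨t, rfl⟩
      simp only [Pi.smul_apply, Matrix.cons_val, smul_eq_mul]
      rw [mul_smul, hc]
      module

end Resolution

/-! ### From a resolution to Bourbaki degree one -/

section BourbakiOfResolution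

variable {k : Type*} [Field k] {f : MvPolynomial (Fin 3) k} {d : ℕ}

/-- A form in an ideal generated by forms of the same degree is a combination of them with
constant coefficients. -/
theorem exists_constant_combination {ι : Type*} [Fintype ι] {w : ι → MvPolynomial (Fin 3) k}
    (hw : ∀ i, (w i).IsHomogeneous d) {g : MvPolynomial (Fin 3) k} (hg : g.IsHomogeneous d)
    (h : g ∈ Ideal.span (Set.range w)) : ∃ t : ι → k, g = ∑ i, C (t i) * w i := by
  obtain ⟨c, hc⟩ := Ideal.mem_span_range_iff_exists_fun.mp h
  refine ⟨fun i => coeff 0 (c i), ?_⟩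
  have h1 := congrArg (homogeneousComponent (0 + d)) hc
  rw [map_sum, homogeneousComponent_of_mem hg, if_pos (zero_add d)] at h1
  rw [← h1]
  refine Finset.sum_congr rfl fun i _ => ?_
  rw [homogeneousComponent_add_mul (hw i), homogeneousComponent_zero]

/-- The second map of the resolution, in the basis of `R(-d)³` given by the partial derivatives:
its columns generate `Syz(J_f)`, with relations generated by the column of the third map. -/
theorem IsNearlyFreeWithExponents.exists_generators {a₁ a₂ : ℕ} (hf : f.IsHomogeneous (d + 1))
    (h : IsNearlyFreeWithExponents f d a₁ a₂) :
    ∃ (s : Fin 3 → Fin 3 → MvPolynomial (Fin 3) k) (r : Fin 3 → MvPolynomial (Fin 3) k),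
      (∀ j, IsHomogeneousVec (s j) (![a₁, a₂, a₂] j)) ∧
      (r 1).IsHomogeneous 1 ∧ (r 2).IsHomogeneous 1 ∧ (∀ j, constantCoeff (r j) = 0) ∧
      (∀ v, v ∈ syz f ↔ ∃ y : Fin 3 → MvPolynomial (Fin 3) k, ∑ j, y j • s j = v) ∧
      (∀ y : Fin 3 → MvPolynomial (Fin 3) k, ∑ j, y j • s j = 0 ↔
        ∃ t : MvPolynomial (Fin 3) k, t • r = y) := by
  obtain ⟨-, -, A₁, A₂, A₃, hA₁, hA₂, hA₃, -, hc₂, hc₃, hspan, hex₁, hex₂, -⟩ := h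
  have hb₁ : ∀ i, (![d, d, d] : Fin 3 → ℕ) i = d := fun i => by fin_cases i <;> rfl
  have hA₁' : ∀ i, (A₁ 0 i).IsHomogeneous d := by
    intro i
    rcases hA₁ 0 i with h0 | ⟨n, hn, hh⟩
    · rw [h0]; exact isHomogeneous_zero _ _ _
    · rw [hb₁, zero_add] at hn
      rwa [hn]
  have hA₂' : ∀ i j, (A₂ i j).IsHomogeneous (![a₁, a₂, a₂] j) := by
    intro i j
    rcases hA₂ i j with h0 | ⟨n, hn, hh⟩
    · rw [h0]; exact isHomogeneous_zero _ _ _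
    · rw [hb₁] at hn
      have : ![a₁, a₂, a₂] j = n := by
        fin_cases j <;> exact Nat.add_left_cancel hn
      rwa [this]
  have hA₃' : ∀ i, i ≠ 0 → (A₃ i 0).IsHomogeneous 1 := by
    intro i hi
    rcases hA₃ i 0 with h0 | ⟨n, hn, hh⟩
    · rw [h0]; exact isHomogeneous_zero _ _ _
    · have : n = 1 := by
        fin_cases i
        · exact absurd rfl hi
        · change d + a₂ + 1 = d + a₂ + n at hn
          omega
        · change d + a₂ + 1 = d + a₂ + n at hn
          omega
      rwa [this] at hh
  have hgrad := grad_isHomogeneous hf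
  -- The first map of the resolution and the gradient differ by an invertible constant matrix.
  choose T hT using fun i => exists_constant_combination hgrad (hA₁' i)
    (show A₁ 0 i ∈ Ideal.span (Set.range (grad f)) from
      (hspan ▸ Ideal.subset_span ⟨i, rfl⟩ : A₁ 0 i ∈ gradientIdeal f))
  choose S hS using fun i => exists_constant_combination hA₁' (hgrad i)
    (show grad f i ∈ Ideal.span (Set.range (A₁ 0)) from
      (hspan ▸ Ideal.subset_span ⟨i, rfl⟩ : grad f i ∈ Ideal.span (Set.range (A₁ 0))))
  -- By minimality of the resolution the generators `A₁ 0 j` of `J_f` are linearly independent.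
  have hind : ∀ q : Fin 3 → k, ∑ j, C (q j) * A₁ 0 j = 0 → q = 0 := by
    intro q hq
    have h1 : A₁.mulVecLin (fun j => C (q j)) = 0 := by
      funext i
      obtain rfl : i = 0 := Subsingleton.elim _ _
      rw [Pi.zero_apply, ← hq]
      change ∑ j, A₁ 0 j * C (q j) = _
      exact Finset.sum_congr rfl fun j _ => mul_comm _ _
    obtain ⟨y, hy⟩ := (hex₁ _).mp h1
    funext i
    have h2 : ∑ j, A₂ i j * y j = C (q i) := congrFun hy i
    have h3 := congrArg constantCoeff h2
    rw [map_sum, constantCoeff_C] at h3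
    rw [← h3, Pi.zero_apply]
    exact Finset.sum_eq_zero fun j _ => by rw [map_mul, hc₂, zero_mul]
  let T' : Matrix (Fin 3) (Fin 3) (MvPolynomial (Fin 3) k) := (Matrix.of T).map C
  let S' : Matrix (Fin 3) (Fin 3) (MvPolynomial (Fin 3) k) := (Matrix.of S).map C
  have hT' : A₁ 0 = T' *ᵥ grad f := funext hT
  have hS' : grad f = S' *ᵥ A₁ 0 := funext hS
  have hTS : Matrix.of T * Matrix.of S = 1 := by
    rw [← sub_eq_zero]
    funext i
    refine hind _ ?_
    have h1 : A₁ 0 i = ((Matrix.of T * Matrix.of S).map C *ᵥ A₁ 0) i := by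
      conv_lhs => rw [hT', hS', Matrix.mulVec_mulVec]
      rw [Matrix.map_mul]
    have h2 : A₁ 0 i = ((1 : Matrix (Fin 3) (Fin 3) k).map C *ᵥ A₁ 0) i := by
      rw [Matrix.map_one _ (map_zero C) (map_one C), Matrix.one_mulVec]
    have h3 := sub_eq_zero.mpr (h1.symm.trans h2)
    rw [← h3, Matrix.mulVec, Matrix.mulVec, dotProduct, dotProduct, ← Finset.sum_sub_distrib]
    refine Finset.sum_congr rfl fun j _ => ?_
    rw [Matrix.sub_apply, map_sub, sub_mul, Matrix.map_apply, Matrix.map_apply]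
  have hTS' : T' * S' = 1 := by
    rw [← Matrix.map_mul, hTS, Matrix.map_one _ (map_zero C) (map_one C)]
  have hST' : S' * T' = 1 := mul_eq_one_comm.mp hTS'
  have hB : ∀ y : Fin 3 → MvPolynomial (Fin 3) k,
      ∑ j, y j • (fun i => (T'ᵀ * A₂) i j) = (A₂ *ᵥ y) ᵥ* T' := by
    intro y
    rw [← Matrix.mulVec_transpose, Matrix.mulVec_mulVec]
    exact sum_smul_eq_mulVec (fun j i => (T'ᵀ * A₂) i j) y
  refine ⟨fun j i => (T'ᵀ * A₂) i j, fun j => A₃ j 0, fun j i => ?_, hA₃' 1 (by decide),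
    hA₃' 2 (by decide), fun j => hc₃ j 0, fun v => ?_, fun y => ?_⟩
  · change (∑ l, T'ᵀ i l * A₂ l j).IsHomogeneous _
    exact IsHomogeneous.sum _ _ _ fun l _ => (hA₂' l j).C_mul (T l i)
  · have h1 : v ∈ syz f ↔ A₁.mulVecLin (v ᵥ* S') = 0 := by
      rw [mem_syz, hS', Matrix.dotProduct_mulVec, dotProduct_comm]
      constructor
      · intro h
        funext i
        obtain rfl : i = 0 := Subsingleton.elim _ _
        exact h
      · exact fun h => congrFun h 0
    rw [h1, hex₁ (v ᵥ* S'), Set.mem_range]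
    refine exists_congr fun y => ?_
    rw [hB, Matrix.mulVecLin_apply]
    constructor
    · intro h
      rw [h, Matrix.vecMul_vecMul, hST', Matrix.vecMul_one]
    · rintro rfl
      rw [Matrix.vecMul_vecMul, hTS', Matrix.vecMul_one]
  · rw [hB]
    have h1 : (A₂ *ᵥ y) ᵥ* T' = 0 ↔ A₂.mulVecLin y = 0 := by
      rw [Matrix.mulVecLin_apply]
      constructor
      · intro h
        have := congrArg (fun u => u ᵥ* S') h
        simpa only [Matrix.vecMul_vecMul, hTS', Matrix.vecMul_one, Matrix.zero_vecMul] using this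
      · intro h
        rw [h, Matrix.zero_vecMul]
    rw [h1, hex₂ y, Set.mem_range]
    constructor
    · rintro ⟨t, rfl⟩
      refine ⟨t 0, funext fun i => ?_⟩
      simp [Matrix.mulVec, dotProduct, mul_comm]
    · rintro ⟨t, rfl⟩
      refine ⟨fun _ => t, funext fun i => ?_⟩
      simp [Matrix.mulVec, dotProduct, mul_comm]

/-- For a nearly free curve the first generator `ε` has least degree and the other two map to
generators of the Bourbaki ideal; their only relation has linear coefficients `r₁`, `r₂`, so the
Bourbaki ideal, having no divisorial component, is `(r₁, r₂)`. -/
theorem IsNearlyFreeWithExponents.isBourbakiDegree_one_and_add_eq {a₁ a₂ : ℕ}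
    (hf : f.IsHomogeneous (d + 1)) (hg : IsPrimitiveVec (grad f))
    (h : IsNearlyFreeWithExponents f d a₁ a₂) :
    IsBourbakiDegree f d 1 ∧ a₁ + a₂ = d + 1 := by
  have ha : a₁ ≤ a₂ := h.2.1
  obtain ⟨s, r, hs, hr1, hr2, hr, hsyz, hrel⟩ := h.exists_generators hf
  have hs0 : IsHomogeneousVec (s 0) a₁ := hs 0
  have hs1 : IsHomogeneousVec (s 1) a₂ := hs 1
  have hmem : ∀ j, s j ∈ syz f := by
    intro j
    refine (hsyz _).mpr ⟨Pi.single j 1, ?_⟩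
    rw [Finset.sum_eq_single j (fun i _ hi => by rw [Pi.single_eq_of_ne hi, zero_smul])
      (fun h => absurd (Finset.mem_univ j) h), Pi.single_eq_same, one_smul]
  -- If `s 0 = 0`, the first basis vector is a relation, but all entries of `r` lie in `(x, y, z)`.
  have hs00 : s 0 ≠ 0 := by
    intro h0
    obtain ⟨t, ht⟩ := (hrel (Pi.single 0 1)).mp (by
      rw [Finset.sum_eq_single 0 (fun i _ hi => by rw [Pi.single_eq_of_ne hi, zero_smul])
        (fun h => absurd (Finset.mem_univ _) h), h0, smul_zero])
    have h1 := congrArg constantCoeff (congrFun ht 0)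
    rw [Pi.smul_apply, smul_eq_mul, map_mul, hr, mul_zero, Pi.single_eq_same, map_one] at h1
    exact zero_ne_one h1
  have he : IsInitialSyzygyDegree f a₁ := by
    refine ⟨⟨s 0, hmem 0, hs00, hs0⟩, ?_⟩
    rintro n ⟨v, hv, hv0, hvn⟩
    by_contra! hlt
    obtain ⟨y, rfl⟩ := (hsyz v).mp hv
    refine hv0 (funext fun i => ?_)
    have h1 := homogeneousComponent_of_mem (m := n) (n := n) (hvn i)
    rw [if_pos rfl, Finset.sum_apply, map_sum] at h1
    rw [Finset.sum_apply, ← h1, Pi.zero_apply]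
    refine Finset.sum_eq_zero fun j _ => homogeneousComponent_mul_of_lt (hs j i) _ ?_
    refine hlt.trans_le ?_
    fin_cases j
    exacts [le_rfl, ha, ha]
  have hε : (⟨s 0, hmem 0⟩ : syz f) ≠ 0 := fun h => hs00 (congrArg Subtype.val h)
  have hεp := isPrimitiveVec_of_isInitialSyzygyDegree hf he (hmem 0) hs00 hs0
  obtain ⟨φ, hker, hgr, hεI, hB⟩ := exists_isBourbakiIdeal hf hg he hε hs0
  have hφ0 : φ ⟨s 0, hmem 0⟩ = 0 := by
    rw [← LinearMap.mem_ker, hker]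
    exact Submodule.mem_span_singleton_self _
  set g₁ := φ ⟨s 1, hmem 1⟩ with hg₁
  set g₂ := φ ⟨s 2, hmem 2⟩ with hg₂
  have hcoe : ∀ (y : Fin 3 → MvPolynomial (Fin 3) k),
      φ (∑ j, y j • (⟨s j, hmem j⟩ : syz f)) = y 1 * g₁ + y 2 * g₂ := by
    intro y
    rw [Fin.sum_univ_three, map_add, map_add, map_smul, map_smul, map_smul, hφ0, smul_zero,
      zero_add, smul_eq_mul, smul_eq_mul]
  have hval : ∀ y : Fin 3 → MvPolynomial (Fin 3) k,
      ((∑ j, y j • (⟨s j, hmem j⟩ : syz f) : syz f) : Fin 3 → MvPolynomial (Fin 3) k) =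
        ∑ j, y j • s j := by
    intro y
    rw [Submodule.coe_sum]
    rfl
  have hrange : ∀ g, g ∈ LinearMap.range φ ↔ ∃ y : Fin 3 → MvPolynomial (Fin 3) k,
      g = y 1 * g₁ + y 2 * g₂ := by
    intro g
    constructor
    · rintro ⟨v, rfl⟩
      obtain ⟨y, hy⟩ := (hsyz v).mp v.2
      refine ⟨y, ?_⟩
      rw [← hcoe]
      exact congrArg φ (Subtype.ext ((hval y).trans hy)).symm
    · rintro ⟨y, rfl⟩
      exact ⟨_, hcoe y⟩
  have hrel' : ∀ x y : MvPolynomial (Fin 3) k, x * g₁ + y * g₂ = 0 →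
      ∃ t, x = t * r 1 ∧ y = t * r 2 := by
    intro x y hxy
    have h1 := hcoe ![0, x, y]
    simp only [Matrix.cons_val] at h1
    rw [hxy, ← LinearMap.mem_ker, hker, Submodule.mem_span_singleton] at h1
    obtain ⟨c, hc⟩ := h1
    have h2 := congrArg Subtype.val hc
    rw [hval] at h2
    obtain ⟨t, ht⟩ := (hrel ![-c, x, y]).mp (by
      rw [Fin.sum_univ_three] at h2 ⊢
      simp only [Matrix.cons_val] at h2 ⊢
      change c • s 0 = _ at h2
      rw [zero_smul, zero_add] at h2
      rw [add_assoc, ← h2, neg_smul, neg_add_cancel])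
    exact ⟨t, (congrFun ht 1).symm, (congrFun ht 2).symm⟩
  obtain ⟨u, hu1, hu2⟩ := hrel' g₂ (-g₁) (by ring)
  have hg1u : g₁ = -(u * r 2) := by rw [← hu2, neg_neg]
  have hdvd : ∀ q : MvPolynomial (Fin 3) k, q ∣ g₁ → q ∣ g₂ → IsUnit q := by
    intro q hq1 hq2
    refine hεp q fun i => ?_
    obtain ⟨y, hy⟩ := (hrange _).mp (hεI i)
    change q ∣ (⟨s 0, hmem 0⟩ : syz f).1 i
    rw [hy]
    exact dvd_add (hq1.mul_left _) (hq2.mul_left _)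
  -- `u` divides both generators of `I`, which lies in no proper principal ideal.
  have hu : IsUnit u := hdvd u (hg1u ▸ (dvd_mul_right u _).neg_right) (hu1 ▸ dvd_mul_right u _)
  have hspan : (LinearMap.range φ : Ideal (MvPolynomial (Fin 3) k)) = Ideal.span {r 1, r 2} := by
    obtain ⟨w, hw⟩ := hu.exists_right_inv
    ext g
    rw [hrange, Ideal.mem_span_pair]
    constructor
    · rintro ⟨y, rfl⟩
      exact ⟨y 2 * u, -(y 1 * u), by rw [hg1u, hu1]; ring⟩
    · rintro ⟨x, y, rfl⟩
      refine ⟨![0, -(y * w), x * w], ?_⟩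
      simp only [Matrix.cons_val]
      rw [hg1u, hu1]
      linear_combination (-(x * r 1) - y * r 2) * hw
  have hnotunit : ∀ q : MvPolynomial (Fin 3) k, constantCoeff q = 0 → ¬ IsUnit q := by
    intro q hq hqu
    have := hqu.map (constantCoeff (σ := Fin 3) (R := k))
    rw [hq] at this
    exact not_isUnit_zero this
  have hdvd' : ∀ q : MvPolynomial (Fin 3) k, constantCoeff q = 0 → q ∣ r 1 → q ∣ r 2 → False :=
    fun q hq h1 h2 => hnotunit q hq
      (hdvd q (hg1u ▸ (h2.mul_left u).neg_right) (hu1 ▸ h1.mul_left u))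
  have hr20 : r 2 ≠ 0 := fun h0 => hdvd' (r 1) (hr 1) dvd_rfl (h0 ▸ dvd_zero _)
  refine ⟨?_, ?_⟩
  · obtain ⟨a, hra⟩ := isHomogeneous_one_eq_linearForm hr1
    obtain ⟨b, hrb⟩ := isHomogeneous_one_eq_linearForm hr2
    have hab : a ⨯₃ b ≠ 0 := by
      intro h0
      obtain ⟨j, hj⟩ : ∃ j, b j ≠ 0 := by
        by_contra! hb
        exact hr20 (by rw [hrb, linearForm]; exact Finset.sum_eq_zero fun i _ => by simp [hb i])
      -- Proportional linear forms have a common factor.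
      have h1 : C (b j) * r 1 = C (a j) * r 2 := by
        rw [hra, hrb, linearForm, linearForm, Finset.mul_sum, Finset.mul_sum]
        refine Finset.sum_congr rfl fun i _ => ?_
        rw [← mul_assoc, ← mul_assoc, ← C_mul, ← C_mul, mul_comm (b j),
          cross_eq_zero_iff.mp h0 i j]
      refine hdvd' (r 2) (hr 2) ?_ dvd_rfl
      exact ((IsUnit.mk0 _ hj).map C).dvd_mul_left.mp (h1 ▸ dvd_mul_left _ _)
    refine ⟨a₁, _, _, he, hε, hs0, hB, ?_⟩
    rw [hspan, hra, hrb]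
    exact hasDegree_of_forall_eq (N := 0) one_ne_zero
      fun n _ => hilbertFunction_span_linearForm hab n
  · have hg10 : g₁ ≠ 0 := by
      rw [hg1u]
      exact neg_ne_zero.mpr (mul_ne_zero hu.ne_zero hr20)
    obtain ⟨m, hm, hgm⟩ := (hgr a₂ ⟨s 1, hmem 1⟩ hs1).resolve_left hg10
    have hu0 : u.IsHomogeneous 0 := by
      have h1 : IsUnit u := hu
      rw [MvPolynomial.isUnit_iff_eq_C_of_isReduced] at h1
      obtain ⟨c, -, hc⟩ := h1
      rw [hc]
      exact isHomogeneous_C _ _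
    have h1 : g₁.IsHomogeneous (0 + 1) := by
      rw [hg1u]
      exact (hu0.mul hr2).neg
    have := hgm.inj_right h1 hg10
    omega

end BourbakiOfResolution

end PlaneCurve

theorem mainTheorem3 {k : Type*} [Field k] [IsAlgClosed k] (d : ℕ) (hd : 1 ≤ d)
    (hchar : ((d + 1 : ℕ) : k) ≠ 0) (f : MvPolynomial (Fin 3) k)
    (hf0 : f ≠ 0) (hf : f.IsHomogeneous (d + 1)) (hred : (Ideal.span {f}).IsRadical) :
    (∃! b : ℕ, PlaneCurve.IsBourbakiDegree f d b) ∧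
    (PlaneCurve.IsBourbakiDegree f d 1 ↔ PlaneCurve.IsNearlyFree f d) ∧
    (∀ a₁ a₂ : ℕ, PlaneCurve.IsNearlyFreeWithExponents f d a₁ a₂ → a₁ + a₂ = d + 1) := by
  have hinf : Infinite k := IsAlgClosed.instInfinite
  have hg := PlaneCurve.isPrimitiveVec_grad hchar hf0 hf hred
  refine ⟨?_, ⟨PlaneCurve.isNearlyFree_of_isBourbakiDegree_one hd hf hg, ?_⟩, fun a₁ a₂ h => ?_⟩
  · obtain ⟨b, hb⟩ := PlaneCurve.exists_isBourbakiDegree hf hg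
    exact ⟨b, hb, fun b' hb' => hb'.unique hf hg hb⟩
  · rintro ⟨a₁, a₂, h⟩
    exact (h.isBourbakiDegree_one_and_add_eq hf hg).1
  · exact (h.isBourbakiDegree_one_and_add_eq hf hg).2
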